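/- Let $d\ge 1$, let $G$ be a compact (Hausdorff) abelian group with normalized Haar measure $\mu$, and let $(T^{\underline\ell})_{\underline\ell\in\mathbb Z^d}$ be a $\mathbb Z^d$-action on $G$ by continuous group automorphisms which is totally ergodic, i.e. $T^{\underline\ell}$ is ergodic for $\mu$ for every $\underline\ell\neq \underline 0$. Let $(w_n)_{n\ge1}$ be a summation sequence on $\mathbb Z^d$, i.e. functions $w_n:\mathbb Z^d\to[0,\infty)$ with $0<\sum_{\underline\ell} w_n(\underline\ell)<\infty$, and let $\zeta$ be a probability measure on $\mathbb T^d=(\mathbb R/\mathbb Z)^d$. Suppose that $(w_n)$ is $\zeta$-regular: the measures $\tilde w_n(\underline t)\,d\underline t$ on $\mathbb T^d$, with $$\tilde w_n(\underline t)=\frac{\bigl|\sum_{\underline\ell} w_n(\underline\ell)\,e^{2\pi i\langle\underline\ell,\underline t\rangle}\bigr|^2}{\sum_{\underline\ell} w_n(\underline\ell)^2},$$ converge weakly to $\zeta$ as $n\to\infty$. Let $f:G\to\mathbb R$ be a regular function, i.e. $\int f\,d\mu=0$ and $f$ is everywhere the sum of its Fourier series, whose coefficients $c_f(\chi)=\int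 f\,\overline\chi\,d\mu$ satisfy $\sum_{\chi\in\widehat G}|c_f(\chi)|<\infty$. For complex random variables, put $C(X_1,\dots,X_r)=\sum_{\pi}(-1)^{|\pi|-1}(|\pi|-1)!\prod_{I\in\pi}\mathbb E\bigl[\prod_{i\in I}X_i\bigr]$, the sum being over all partitions $\pi$ of $\{1,\dots,r\}$ into nonempty subsets. For a finite set $\Phi$ of characters of $G$, let $\mathcal N(\Phi,r)$ be the set of non-mixing $r$-tuples, i.e. of those $(\underline a_1,\dots,\underline a_r)\in(\mathbb Z^d)^r$ for which there are $\chi_1,\dots,\chi_r\in\Phi$ with $C(\chi_1\circ T^{\underline a_1},\dots,\chi_r\circ T^{\underline a_r})\neq0$ (cumulant with respect to $\mu$). Assume that, for every $r\ge3$ and every finite set $\Phi$ of characters of $G$, $$\sum_{(\underline\ell_1,\dots,\underline\ell_r)\in\mathcal N(\Phi,r)}\ \prod_{j=1}^r w_n(\underline\ell_j)=o\Bigl(\bigl(\sum_{\underline\ell\in\mathbb Z^d} w_n(\underline\ell)^2\bigr)^{r/2}\Bigr)\qquad(n\to\infty).$$ Then $f$ has a continuous spectral density $\varphi_f\ge0$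 on $\mathbb T^d$, i.e. $\int_{\mathbb T^d}\varphi_f(\underline t)\,e^{-2\pi i\langle\underline\ell,\underline t\rangle}\,d\underline t=\int_G f(T^{\underline\ell}x)f(x)\,d\mu(x)$ for all $\underline\ell\in\mathbb Z^d$; and if $\zeta(\varphi_f):=\int\varphi_f\,d\zeta>0$, then $$\Bigl(\sum_{\underline\ell\in\mathbb Z^d}w_n(\underline\ell)^2\Bigr)^{-1/2}\sum_{\underline\ell\in\mathbb Z^d}w_n(\underline\ell)\,f\circ T^{\underline\ell}\ \longrightarrow\ \mathcal N\bigl(0,\zeta(\varphi_f)\bigr)$$ in distribution with respect to $\mu$, as $n\to\infty$. -/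

import Mathlib

open MeasureTheory ProbabilityTheory Filter Topology

noncomputable section

namespace CLTAction

variable {d : ℕ}

/-! ### Summation sequences on `ℤ^d` -/

/-- A summation sequence: nonnegative weights on `ℤ^d` with `0 < ∑ w n < ∞` for every `n`. -/
structure IsSummationSequence (w : ℕ → (Fin d → ℤ) → ℝ) : Prop where
  nonneg : ∀ n ℓ, 0 ≤ w n ℓ
  summable : ∀ n, Summable (w n)
  pos : ∀ n, 0 < ∑' ℓ, w n ℓ

/-- `∑ w(ℓ)²`; the series converges when `w` is nonnegative and summable. -/
def sumSq (w : (Fin d → ℤ) → ℝ) : ℝ := ∑' ℓ, w ℓ ^ 2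

/-- The Haar probability measure (normalized Lebesgue measure) on the torus `(ℝ/ℤ)^d`. -/
def torusHaar (d : ℕ) : Measure (UnitAddTorus (Fin d)) :=
  Measure.pi fun _ => AddCircle.haarAddCircle

/-- The kernel `|∑ w(ℓ) exp(2πi⟨ℓ,t⟩)|² / ∑ w(ℓ)²` on the torus `(ℝ/ℤ)^d`. -/
def kernel (w : (Fin d → ℤ) → ℝ) (t : UnitAddTorus (Fin d)) : ℝ :=
  ‖∑' ℓ, (w ℓ : ℂ) * UnitAddTorus.mFourier ℓ t‖ ^ 2 / sumSq w

/-- `w` is `ζ`-regular: the probability measures with density `kernel (w n)` with respect to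
Lebesgue measure on the torus converge weakly to `ζ`. -/
def IsRegularSequence (w : ℕ → (Fin d → ℤ) → ℝ) (ζ : Measure (UnitAddTorus (Fin d))) : Prop :=
  ∀ g : C(UnitAddTorus (Fin d), ℝ),
    Tendsto (fun n => ∫ t, kernel (w n) t * g t ∂(torusHaar d)) atTop (𝓝 (∫ t, g t ∂ζ))

/-! ### Functions on a compact abelian group -/

variable {G : Type*} [CommGroup G] [TopologicalSpace G] [MeasurableSpace G]

/-- The Fourier coefficient `∫ f χ̄ dμ` of `f` at the character `χ`. -/
def fourierCoefficient (μ : Measure G) (f : G → ℝ) (χ : PontryaginDual G) : ℂ :=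
  ∫ x, (f x : ℂ) * (starRingEnd ℂ) (χ x : ℂ) ∂μ

/-- The real space `AC₀(G)`: functions with zero mean that are everywhere the sum of their
absolutely convergent Fourier series. -/
structure IsRegularFunction (μ : Measure G) (f : G → ℝ) : Prop where
  summable : Summable fun χ : PontryaginDual G => ‖fourierCoefficient μ f χ‖
  eq_tsum : ∀ x, (f x : ℂ) = ∑' χ : PontryaginDual G, fourierCoefficient μ f χ * (χ x : ℂ)
  integral_eq_zero : ∫ x, f x ∂μ = 0

/-! ### Actions of `ℤ^d` by automorphisms -/

/-- The automorphism `T^ℓ` of an action `T` of `ℤ^d` by automorphisms of `G`. -/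
def act (T : Multiplicative (Fin d → ℤ) →* MulAut G) (ℓ : Fin d → ℤ) : G → G :=
  T (Multiplicative.ofAdd ℓ)

/-- `T^ℓ` is ergodic for every `ℓ ≠ 0`. -/
def IsTotallyErgodic (T : Multiplicative (Fin d → ℤ) →* MulAut G) (μ : Measure G) : Prop :=
  ∀ ℓ : Fin d → ℤ, ℓ ≠ 0 → Ergodic (act T ℓ) μ

/-- `φ` is a density of the spectral measure of `f`, the positive finite measure on the torus
whose Fourier coefficients are `⟨T^ℓ f, f⟩`, `ℓ ∈ ℤ^d`. -/
structure IsSpectralDensity (T : Multiplicative (Fin d → ℤ) →* MulAut G) (μ : Measure G)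
    (f : G → ℝ) (φ : UnitAddTorus (Fin d) → ℝ) : Prop where
  nonneg : ∀ t, 0 ≤ φ t
  integrable : Integrable φ (torusHaar d)
  coeff : ∀ ℓ : Fin d → ℤ,
    UnitAddTorus.mFourierCoeff (fun t => (φ t : ℂ)) ℓ = ((∫ x, f (act T ℓ x) * f x ∂μ : ℝ) : ℂ)

/-- The cumulant `∑_π (-1)^(|π|-1) (|π|-1)! ∏_{I ∈ π} E[∏_{i ∈ I} X_i]` of a complex random
vector, the sum being over the partitions `π` of the index set into nonempty subsets. -/
def cumulant {r : ℕ} (μ : Measure G) (X : Fin r → G → ℂ) : ℂ :=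
  ∑ π : Finpartition (Finset.univ : Finset (Fin r)),
    (-1 : ℂ) ^ (π.parts.card - 1) * ((π.parts.card - 1).factorial : ℂ) *
      ∏ I ∈ π.parts, ∫ x, ∏ i ∈ I, X i x ∂μ

/-- The set of non-mixing `r`-tuples for a finite family `Φ` of characters. -/
def nonMixing (T : Multiplicative (Fin d → ℤ) →* MulAut G) (μ : Measure G)
    (Φ : Finset (PontryaginDual G)) (r : ℕ) : Set (Fin r → Fin d → ℤ) :=
  {a | ∃ χ : Fin r → PontryaginDual G, (∀ j, χ j ∈ Φ) ∧
    cumulant μ (fun j x => (χ j (act T (a j) x) : ℂ)) ≠ 0}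

/-- The normalized sum `(∑ w(ℓ)²)^(-1/2) ∑ w(ℓ) f(T^ℓ x)`. -/
def normalizedSum (T : Multiplicative (Fin d → ℤ) →* MulAut G) (w : (Fin d → ℤ) → ℝ)
    (f : G → ℝ) (x : G) : ℝ :=
  sumSq w ^ (-(1 / 2) : ℝ) * ∑' ℓ, w ℓ * f (act T ℓ x)

end CLTAction

end

/-! Dividing `w n` by its `ℓ²` norm gives weights `u n` with `∑ u² = 1`. Two mechanisms then drive
the theorem.

Orbits of characters. A character fixed by some `T^ℓ` with `ℓ ≠ 0` is an invariant function, so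
ergodicity makes it trivial (`dualAct_ne_self`). Along the orbit of a nontrivial character the
functions `χ ∘ T^ℓ` are therefore distinct, hence orthonormal, and `∑ u(ℓ) g ∘ T^ℓ` has `L²` norm at
most `∑ |c_g(χ)|` times the `ℓ²` norm of `u` (`norm_toL2_sum_le`). Replacing `f` by a trigonometric
polynomial thus costs an `L²` error that is small uniformly in `n`. The same freeness gives `∑_ℓ
|⟨T^ℓ f, f⟩| ≤ (∑ |c_f(χ)|)²` (`summable_autocorrelation`), so the spectral density is a uniformly
convergent Fourier series. The variance of the normalized sum is the integral of this density
against the kernel of `w n` (`integral_sq_tsum`), and tends to `ζ(φ_f)` by regularity.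

Cumulants. For a trigonometric polynomial, multilinearity expands the cumulant of order `r` over
`r`-tuples of exponents. Only non-mixing tuples contribute, so the hypothesis kills every order `r ≥
3` (`norm_momentCumulant_sum_le`). The moment-cumulant recursion then makes the moments
asymptotically Gaussian, and Taylor's formula carries this to characteristic functions
(`tendsto_charFun_sub_exp`). The Gaussian there has the variance at time `n`, so the variances of
the truncated sums need not converge; `tendsto_charFun_tsum` compares them with those of the full
sums. Lévy's continuity theorem concludes. -/

noncomputable section

namespace CLTAction


/-! ### The moment-cumulant recursion -/

section Partitions

variable {α : Type*} [DecidableEq α]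

/-- The coefficient `(-1)^(p-1) (p-1)!` of a partition with `p` parts in a cumulant. -/
def cumulantCoeff (p : ℕ) : ℂ := (-1 : ℂ) ^ (p - 1) * ((p - 1).factorial : ℂ)

/-- The cumulant of a set function of moments. -/
def setCumulant (m : Finset α → ℂ) (s : Finset α) : ℂ :=
  ∑ π : Finpartition s, cumulantCoeff π.parts.card * ∏ I ∈ π.parts, m I

/-- The cancellation behind the recursion: a partition with `p` parts occurs once in the cumulant of
the whole set, and `p - 1` times through the removal of one part that avoids the marked point. -/
lemma cumulantCoeff_add {p : ℕ} (hp : 2 ≤ p) :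
    cumulantCoeff p + ((p : ℂ) - 1) * cumulantCoeff (p - 1) = 0 := by
  obtain ⟨q, rfl⟩ := Nat.exists_eq_add_of_le' hp
  simp only [cumulantCoeff, Nat.add_sub_cancel, show q + 2 - 1 = q + 1 by omega,
    Nat.factorial_succ, pow_succ]
  push_cast
  ring

lemma card_parts_filter_notMem {s : Finset α} {a : α} (ha : a ∈ s) (ρ : Finpartition s) :
    (ρ.parts.filter fun J => a ∉ J).card + 1 = ρ.parts.card := by
  have h : (ρ.parts.filter fun J => a ∈ J).card = 1 := by
    rw [Finset.card_eq_one]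
    refine ⟨ρ.part a, ?_⟩
    ext J
    simp only [Finset.mem_filter, Finset.mem_singleton]
    constructor
    · rintro ⟨hJ, haJ⟩
      exact (ρ.part_eq_of_mem hJ haJ).symm
    · rintro rfl
      exact ⟨ρ.part_mem.2 ha, ρ.mem_part ha⟩
  have := Finset.card_filter_add_card_filter_not (s := ρ.parts) (fun J => a ∈ J)
  omega

/-- A partition of a proper subset `B` containing `a` becomes a partition of `s` when the block `s \
B` is added. Conversely, removing a block `J` that avoids `a` recovers `B = s \ J` and its
partition. -/
lemma sum_proper_setCumulant (m : Finset α → ℂ) {s : Finset α} {a : α} (ha : a ∈ s) :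
    ∑ B ∈ s.powerset with a ∈ B ∧ B ≠ s, setCumulant m B * m (s \ B) =
      ∑ ρ : Finpartition s, ∑ J ∈ ρ.parts with a ∉ J,
        cumulantCoeff (ρ.parts.card - 1) * ∏ I ∈ ρ.parts, m I := by
  simp only [setCumulant, Finset.sum_mul]
  rw [Finset.sum_sigma', Finset.sum_sigma']
  have hne : ∀ x : (Σ B : Finset α, Finpartition B),
      x ∈ ({B ∈ s.powerset | a ∈ B ∧ B ≠ s}.sigma fun B => Finset.univ) →
        s \ x.1 ≠ ⊥ ∧ Disjoint x.1 (s \ x.1) ∧ x.1 ⊔ s \ x.1 = s := by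
    rintro ⟨B, π⟩ hx
    simp only [Finset.mem_sigma, Finset.mem_filter, Finset.mem_powerset, Finset.mem_univ,
      and_true] at hx
    refine ⟨?_, Finset.disjoint_sdiff, by simpa using hx.1⟩
    intro h
    exact hx.2.2 (Finset.Subset.antisymm hx.1 (Finset.sdiff_eq_empty_iff_subset.1 h))
  have hnotMem : ∀ (B : Finset α) (π : Finpartition B), s \ B ≠ ⊥ → s \ B ∉ π.parts := by
    intro B π h hmem
    obtain ⟨x, hx⟩ := Finset.nonempty_iff_ne_empty.2 h
    exact (Finset.mem_sdiff.1 hx).2 (π.le hmem hx)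
  refine Finset.sum_bij (fun x hx => ⟨x.2.extend (hne x hx).1 (hne x hx).2.1 (hne x hx).2.2,
    s \ x.1⟩) ?_ ?_ ?_ ?_
  · rintro ⟨B, π⟩ hx
    simp only [Finset.mem_sigma, Finset.mem_filter, Finset.mem_powerset, Finset.mem_univ,
      and_true] at hx
    simp [Finpartition.extend, hx.2.1]
  · rintro ⟨B, π⟩ hx ⟨B', π'⟩ hx' h
    simp only [Sigma.mk.injEq, heq_eq_eq] at h
    have hB : B = B' := by
      simp only [Finset.mem_sigma, Finset.mem_filter, Finset.mem_powerset, Finset.mem_univ,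
        and_true] at hx hx'
      rw [← Finset.sdiff_sdiff_eq_self hx.1, h.2, Finset.sdiff_sdiff_eq_self hx'.1]
    subst hB
    have hp := congrArg Finpartition.parts h.1
    simp only [Finpartition.extend] at hp
    have : π.parts = π'.parts := by
      rw [← Finset.erase_insert (hnotMem B π (hne _ hx).1), hp,
        Finset.erase_insert (hnotMem B π' (hne _ hx).1)]
    rw [Finpartition.ext this]
  · rintro ⟨ρ, J⟩ hx
    simp only [Finset.mem_sigma, Finset.mem_filter, Finset.mem_univ, true_and] at hx
    obtain ⟨hJ, haJ⟩ := hx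
    have hsub : J ⊆ s := ρ.le hJ
    have hsup : (ρ.parts.erase J).sup id = s \ J := by
      have h1 : J ⊔ (ρ.parts.erase J).sup id = s := by
        have h := ρ.sup_parts
        rwa [← Finset.insert_erase hJ, Finset.sup_insert] at h
      have h2 : Disjoint J ((ρ.parts.erase J).sup id) := by
        rw [Finset.disjoint_sup_right]
        intro I hI
        exact ρ.disjoint hJ (Finset.mem_of_mem_erase hI) (Finset.ne_of_mem_erase hI).symm
      exact (Finset.union_sdiff_cancel_left h2).symm.trans (congrArg (· \ J) h1)
    have hss : s \ (s \ J) = J := Finset.sdiff_sdiff_eq_self hsub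
    refine ⟨⟨s \ J, ρ.ofSubset (Finset.erase_subset J ρ.parts) hsup⟩, ?_, ?_⟩
    · simp only [Finset.mem_sigma, Finset.mem_filter, Finset.mem_powerset, Finset.mem_univ,
        and_true]
      refine ⟨Finset.sdiff_subset, Finset.mem_sdiff.2 ⟨ha, haJ⟩, fun h => ?_⟩
      rw [h, Finset.sdiff_self] at hss
      exact ρ.ne_bot hJ hss.symm
    · simp only [Sigma.mk.injEq, heq_eq_eq]
      refine ⟨Finpartition.ext ?_, hss⟩
      simp only [Finpartition.extend, Finpartition.ofSubset, hss]
      exact Finset.insert_erase hJ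
  · rintro ⟨B, π⟩ hx
    simp only [Finpartition.extend]
    rw [Finset.prod_insert (hnotMem B π (hne _ hx).1),
      Finset.card_insert_of_notMem (hnotMem B π (hne _ hx).1), Nat.add_sub_cancel]
    ring

/-- The moment-cumulant recursion. -/
theorem sum_setCumulant_mul (m : Finset α → ℂ) (h0 : m ∅ = 1) {s : Finset α} {a : α}
    (ha : a ∈ s) :
    ∑ B ∈ s.powerset with a ∈ B, setCumulant m B * m (s \ B) = m s := by
  have hs : s ∈ {B ∈ s.powerset | a ∈ B} := by simp [ha]
  rw [← Finset.add_sum_erase _ _ hs]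
  have he : {B ∈ s.powerset | a ∈ B}.erase s = {B ∈ s.powerset | a ∈ B ∧ B ≠ s} := by
    ext B
    simp only [Finset.mem_erase, Finset.mem_filter]
    tauto
  rw [he, sum_proper_setCumulant m ha, Finset.sdiff_self, h0, mul_one, setCumulant,
    ← Finset.sum_add_distrib]
  have hsb : s ≠ ⊥ := Finset.ne_empty_of_mem ha
  -- The one-block partition has no block avoiding `a` and yields `m s`; every other partition
  -- cancels by `cumulantCoeff_add`.
  rw [Finset.sum_eq_single (Finpartition.indiscrete hsb)]
  · have hc := card_parts_filter_notMem ha (Finpartition.indiscrete hsb)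
    rw [Finset.sum_const]
    simp only [Finpartition.indiscrete_parts, Finset.card_singleton, Nat.add_eq_right] at hc ⊢
    simp [hc, cumulantCoeff]
  · intro ρ _ hρ
    have hc := card_parts_filter_notMem ha ρ
    have h2 : 2 ≤ ρ.parts.card := by
      by_contra hlt
      have h1 : ρ.parts.card = 1 := by omega
      obtain ⟨J, hJ⟩ := Finset.card_eq_one.1 h1
      apply hρ
      have := ρ.sup_parts
      rw [hJ, Finset.sup_singleton] at this
      apply Finpartition.ext
      rw [hJ, Finpartition.indiscrete_parts, ← this]
      rfl
    rw [Finset.sum_const, nsmul_eq_mul]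
    have hcc : (({J ∈ ρ.parts | a ∉ J}.card : ℕ) : ℂ) = (ρ.parts.card : ℂ) - 1 := by
      rw [← hc]; push_cast; ring
    rw [hcc, ← mul_assoc, ← add_mul, cumulantCoeff_add h2, zero_mul]
  · simp

end Partitions

/-- The cumulants of the sequence of moments `M`. -/
def momentCumulant (M : ℕ → ℂ) (n : ℕ) : ℂ :=
  setCumulant (fun I : Finset (Fin n) => M I.card) Finset.univ

lemma sum_powerset_mem {α : Type*} [DecidableEq α] (F : Finset α → ℂ) {s : Finset α} {a : α}
    (ha : a ∈ s) :
    ∑ B ∈ s.powerset with a ∈ B, F B = ∑ B ∈ (s.erase a).powerset, F (insert a B) := by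
  symm
  refine Finset.sum_bij (fun B _ => insert a B) ?_ ?_ ?_ (fun _ _ => rfl)
  · intro B hB
    rw [Finset.mem_powerset] at hB
    simp [Finset.insert_subset_iff, ha, hB.trans (Finset.erase_subset a s)]
  · intro B hB B' hB' h
    rw [Finset.mem_powerset] at hB hB'
    have h1 : a ∉ B := fun h => by simpa using hB h
    have h2 : a ∉ B' := fun h => by simpa using hB' h
    rw [← Finset.erase_insert h1, h, Finset.erase_insert h2]
  · intro B hB
    simp only [Finset.mem_filter, Finset.mem_powerset] at hB
    exact ⟨B.erase a, Finset.mem_powerset.2 (Finset.erase_subset_erase a hB.1),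
      Finset.insert_erase hB.2⟩

/-- The recursion with its terms grouped by `j`, the number of elements of `B` other than the marked
point. The hypothesis on `k` concerns smaller sets only, so that the lemma can serve inside an
induction. -/
lemma sum_setCumulant_choose {α : Type*} [DecidableEq α] {M : ℕ → ℂ} (h0 : M 0 = 1)
    {s : Finset α} {n : ℕ} (hs : s.card = n + 1) {k : ℕ → ℂ}
    (hk : ∀ B ⊆ s, B.card ≤ n → B.Nonempty →
      setCumulant (fun I : Finset α => M I.card) B = k B.card) :
    setCumulant (fun I : Finset α => M I.card) s +
      ∑ j ∈ Finset.range n, (n.choose j : ℂ) * (k (j + 1) * M (n - j)) = M (n + 1) := by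
  obtain ⟨a, ha⟩ : s.Nonempty := Finset.card_pos.1 (by omega)
  have hcard : (s.erase a).card = n := by rw [Finset.card_erase_of_mem ha, hs]; rfl
  have h := sum_setCumulant_mul (fun I : Finset α => M I.card) (by simpa using h0) ha
  rw [sum_powerset_mem _ ha] at h
  have hmem : s.erase a ∈ (s.erase a).powerset := by simp
  rw [← Finset.add_sum_erase _ _ hmem, Finset.insert_erase ha, Finset.sdiff_self,
    Finset.card_empty, h0, mul_one, hs] at h
  rw [← h]
  congr 1
  -- The value `0` at `j = n` stands for `B = s`, whose term was split off above.
  set k' : ℕ → ℂ := fun j => if j < n then k (j + 1) * M (n - j) else 0 with hk'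
  have h1 : ∑ B ∈ (s.erase a).powerset, k' B.card =
      ∑ j ∈ Finset.range n, (n.choose j : ℂ) * (k (j + 1) * M (n - j)) := by
    rw [Finset.sum_powerset_apply_card, hcard, Finset.sum_range_succ]
    simp only [hk', lt_irrefl, if_false, smul_zero, add_zero]
    refine Finset.sum_congr rfl fun j hj => ?_
    rw [if_pos (Finset.mem_range.1 hj), nsmul_eq_mul]
  rw [← h1, ← Finset.add_sum_erase _ _ hmem]
  simp only [hk', hcard, lt_irrefl, if_false, zero_add]
  refine Finset.sum_congr rfl fun B hB => ?_
  rw [Finset.mem_erase, Finset.mem_powerset] at hB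
  have haB : a ∉ B := fun h => by simpa using hB.2 h
  have hlt : B.card < n := hcard ▸ Finset.card_lt_card (Finset.ssubset_iff_subset_ne.2 ⟨hB.2, hB.1⟩)
  have hsub : insert a B ⊆ s :=
    Finset.insert_subset ha (hB.2.trans (Finset.erase_subset a s))
  have hci : (insert a B).card = B.card + 1 := Finset.card_insert_of_notMem haB
  rw [if_pos hlt, hk _ hsub (by omega) (Finset.insert_nonempty a B), hci,
    Finset.card_sdiff_of_subset hsub, hci, hs]
  congr 2
  omega

/-- Both sides solve the same recursion with the same lower-order data. The induction runs over all
types at once, to reach `Fin (n + 1)` and its subsets. -/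
lemma setCumulant_eq_momentCumulant {α : Type} [DecidableEq α] {M : ℕ → ℂ} (h0 : M 0 = 1)
    (s : Finset α) (hs : s.Nonempty) :
    setCumulant (fun I : Finset α => M I.card) s = momentCumulant M s.card := by
  induction hn : s.card using Nat.strong_induction_on generalizing α with
  | _ n ih =>
    obtain ⟨n, rfl⟩ : ∃ m, n = m + 1 := ⟨n - 1, by have := Finset.card_pos.2 hs; omega⟩
    have h1 := sum_setCumulant_choose h0 hn (k := momentCumulant M) fun B _ hB hB' =>
      ih B.card (by omega) B hB' rfl
    have h2 := sum_setCumulant_choose (α := Fin (n + 1)) h0 (s := Finset.univ) (Finset.card_fin _)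
      (k := momentCumulant M) fun B _ hB hB' =>
        ih B.card (by omega) B hB' rfl
    exact add_right_cancel (h1.trans h2.symm)

/-- Moments are determined by cumulants. -/
theorem moment_succ_eq_sum {M : ℕ → ℂ} (h0 : M 0 = 1) (n : ℕ) :
    M (n + 1) =
      ∑ j ∈ Finset.range (n + 1), (n.choose j : ℂ) * (momentCumulant M (j + 1) * M (n - j)) := by
  rw [Finset.sum_range_succ, Nat.choose_self, Nat.sub_self, h0, Nat.cast_one, one_mul, mul_one,
    add_comm (Finset.sum _ _)]
  exact (sum_setCumulant_choose (α := Fin (n + 1)) h0 (s := Finset.univ) (Finset.card_fin _)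
      (k := momentCumulant M) fun B _ hB hB' => setCumulant_eq_momentCumulant h0 B hB').symm


/-! ### The method of moments for a Gaussian limit -/

/-- The moments of the centred Gaussian distribution with variance `v`. -/
def gaussianMoment (v : ℂ) : ℕ → ℂ
  | 0 => 1
  | 1 => 0
  | n + 2 => (n + 1) * v * gaussianMoment v n

lemma gaussianMoment_odd (v : ℂ) (m : ℕ) : gaussianMoment v (2 * m + 1) = 0 := by
  induction m with
  | zero => rfl
  | succ m ih =>
    rw [show 2 * (m + 1) + 1 = 2 * m + 1 + 2 by ring, gaussianMoment, ih, mul_zero]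

lemma gaussianMoment_even_div (v : ℂ) (m : ℕ) :
    gaussianMoment v (2 * m) / ((2 * m).factorial : ℂ) = (v / 2) ^ m / (m.factorial : ℂ) := by
  induction m with
  | zero => simp [gaussianMoment]
  | succ m ih =>
    have h1 : ((2 * m).factorial : ℂ) ≠ 0 := by exact_mod_cast (2 * m).factorial_ne_zero
    have h2 : (m.factorial : ℂ) ≠ 0 := by exact_mod_cast m.factorial_ne_zero
    have h3 : (m : ℂ) + 1 ≠ 0 := by exact_mod_cast m.succ_ne_zero
    have h4 : (2 * m : ℂ) + 1 ≠ 0 := by exact_mod_cast (2 * m).succ_ne_zero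
    rw [show 2 * (m + 1) = 2 * m + 2 by ring, gaussianMoment, Nat.factorial_succ,
      Nat.factorial_succ, Nat.factorial_succ, pow_succ]
    push_cast
    have h5 : (2 * m : ℂ) + 1 + 1 ≠ 0 := by
      rw [show (2 * m : ℂ) + 1 + 1 = 2 * (m + 1) by ring]; simp [h3]
    rw [div_eq_div_iff h1 h2] at ih
    rw [div_eq_div_iff (by positivity) (by positivity)]
    linear_combination (2 * (m : ℂ) + 1) * v * (m + 1) * ih

/-- Truncated form of `E exp(zX) = exp(z²v/2)`; odd moments vanish, so `2m` terms on the left match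
`m` on the right. -/
lemma sum_gaussianMoment (v z : ℂ) (m : ℕ) :
    ∑ k ∈ Finset.range (2 * m), z ^ k / (k.factorial : ℂ) * gaussianMoment v k =
      ∑ j ∈ Finset.range m, (z ^ 2 * v / 2) ^ j / (j.factorial : ℂ) := by
  induction m with
  | zero => simp
  | succ m ih =>
    rw [show 2 * (m + 1) = 2 * m + 1 + 1 by ring, Finset.sum_range_succ, Finset.sum_range_succ, ih,
      gaussianMoment_odd, Finset.sum_range_succ, mul_zero, add_zero, div_mul_eq_mul_div,
      mul_div_assoc (z ^ (2 * m)), gaussianMoment_even_div]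
    congr 1
    rw [pow_mul, mul_div_assoc (z ^ 2), mul_pow, mul_div_assoc]

/-- Taylor's bound for the exponential function on the left half-plane. -/
lemma norm_exp_sub_sum_le {z : ℂ} (hz : z.re ≤ 0) (N : ℕ) :
    ‖Complex.exp z - ∑ k ∈ Finset.range N, z ^ k / (k.factorial : ℂ)‖ ≤
      ‖z‖ ^ N / (N.factorial : ℝ) := by
  induction N generalizing z with
  | zero => simpa [Complex.norm_exp] using hz
  | succ N ih =>
    -- The remainder along the segment from `0` to `z`. Its derivative is `z` times the remainder of
    -- the previous order, to which the induction hypothesis applies.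
    let f : ℝ → ℂ := fun s =>
      Complex.exp (s * z) - ∑ k ∈ Finset.range (N + 1), (s * z) ^ k / (k.factorial : ℂ)
    let f' : ℝ → ℂ := fun s =>
      z * (Complex.exp (s * z) - ∑ k ∈ Finset.range N, (s * z) ^ k / (k.factorial : ℂ))
    have hf : ∀ s : ℝ, HasDerivAt f (f' s) s := by
      intro s
      have hl : HasDerivAt (fun s : ℝ => (s : ℂ) * z) z s := by
        simpa using (Complex.ofRealCLM.hasDerivAt (x := s)).mul_const z
      have hs : HasDerivAt
          (fun s : ℝ => ∑ k ∈ Finset.range (N + 1), (s * z) ^ k / (k.factorial : ℂ))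
          (∑ k ∈ Finset.range (N + 1), (k * (s * z) ^ (k - 1) * z) / (k.factorial : ℂ)) s :=
        HasDerivAt.fun_sum fun k _ => (hl.pow k).div_const _
      have he : HasDerivAt f _ s := hl.cexp.sub hs
      refine he.congr_deriv (Eq.symm ?_)
      change z * (_ - _) = _
      rw [Finset.sum_range_succ', mul_sub, Finset.mul_sum]
      simp only [Nat.cast_zero, zero_mul, zero_div, add_zero, Nat.add_sub_cancel]
      congr 1
      · ring
      · refine Finset.sum_congr rfl fun k _ => ?_
        have h1 : (k.factorial : ℂ) ≠ 0 := by exact_mod_cast k.factorial_ne_zero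
        have h2 : (k : ℂ) + 1 ≠ 0 := by exact_mod_cast k.succ_ne_zero
        rw [Nat.factorial_succ]
        push_cast
        field_simp
    let B : ℝ → ℝ := fun s => ‖z‖ ^ (N + 1) / ((N + 1).factorial : ℝ) * s ^ (N + 1)
    let B' : ℝ → ℝ := fun s => ‖z‖ ^ (N + 1) / ((N + 1).factorial : ℝ) * ((N + 1 : ℕ) * s ^ N)
    have hB : ∀ s, HasDerivAt B (B' s) s := by
      intro s
      exact (hasDerivAt_pow (N + 1) s).const_mul (‖z‖ ^ (N + 1) / ((N + 1).factorial : ℝ))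
    have h0 : ‖f 0‖ ≤ B 0 := by
      simp [f, B, Finset.sum_range_succ']
    have hbound : ∀ s ∈ Set.Ico (0 : ℝ) 1, ‖f' s‖ ≤ B' s := by
      intro s hs
      have hre : ((s : ℂ) * z).re ≤ 0 := by
        simpa using mul_nonpos_of_nonneg_of_nonpos hs.1 hz
      have h := ih hre
      simp only [f', B', norm_mul] at h ⊢
      calc ‖z‖ * _ ≤ ‖z‖ * ((‖(s : ℂ)‖ * ‖z‖) ^ N / (N.factorial : ℝ)) := by gcongr
        _ = _ := by
          rw [Complex.norm_real, Real.norm_eq_abs, abs_of_nonneg hs.1, Nat.factorial_succ]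
          have h1 : (N.factorial : ℝ) ≠ 0 := by positivity
          push_cast
          field_simp
          ring
    have := image_norm_le_of_norm_deriv_right_le_deriv_boundary (a := 0) (b := 1)
      (fun s _ => (hf s).continuousAt.continuousWithinAt)
      (fun s _ => (hf s).hasDerivWithinAt) h0 hB hbound (Set.right_mem_Icc.2 zero_le_one)
    simpa [f, B] using this

open Asymptotics in
-- In the recursion the first cumulant vanishes, the second is the variance, and the higher ones are
-- `o(1)` times bounded moments. What survives is the Gaussian recursion. Boundedness of the moments
-- has to be carried along in the induction.
lemma isLittleO_moment_sub_gaussianMoment {M : ℕ → ℕ → ℂ} (h0 : ∀ n, M n 0 = 1)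
    (h1 : ∀ n, M n 1 = 0) (h2 : (fun n => M n 2) =O[atTop] fun _ => (1 : ℝ))
    (h3 : ∀ r, 3 ≤ r → (fun n => momentCumulant (M n) r) =o[atTop] fun _ => (1 : ℝ)) (r : ℕ) :
    (fun n => M n r) =O[atTop] (fun _ => (1 : ℝ)) ∧
      (fun n => M n r - gaussianMoment (M n 2) r) =o[atTop] fun _ => (1 : ℝ) := by
  have k1 : ∀ n, momentCumulant (M n) 1 = 0 := fun n => by
    have := moment_succ_eq_sum (h0 n) 0
    simpa [h0, h1] using this.symm
  have k2 : ∀ n, momentCumulant (M n) 2 = M n 2 := fun n => by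
    have := moment_succ_eq_sum (h0 n) 1
    simpa [h0, h1, Finset.sum_range_succ, k1] using this.symm
  induction r using Nat.strong_induction_on with
  | _ r ih =>
    match r, ih with
    | 0, _ =>
      simp only [h0, gaussianMoment, sub_self]
      exact ⟨isBigO_const_const _ one_ne_zero _, isLittleO_zero _ _⟩
    | 1, _ =>
      simp only [h1, gaussianMoment, sub_self]
      exact ⟨isBigO_zero _ _, isLittleO_zero _ _⟩
    | r + 2, ih =>
      have hdiff : (fun n => M n (r + 2) - (r + 1) * M n 2 * M n r) =o[atTop]
          fun _ => (1 : ℝ) := by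
        have heq : ∀ n, M n (r + 2) - (r + 1) * M n 2 * M n r =
            ∑ j ∈ Finset.range r, ((r + 1).choose (j + 2) : ℂ) *
              (momentCumulant (M n) (j + 3) * M n (r + 1 - (j + 2))) := by
          intro n
          rw [moment_succ_eq_sum (h0 n) (r + 1), Finset.sum_range_succ', Finset.sum_range_succ']
          simp only [k1, k2, zero_add, zero_mul, mul_zero, add_zero, Nat.choose_one_right]
          push_cast
          ring
        simp only [heq]
        refine IsLittleO.fun_sum fun j _ => ?_
        refine IsLittleO.const_mul_left ?_ _
        simpa using (h3 (j + 3) (by omega)).mul_isBigO (ih (r + 1 - (j + 2)) (by omega)).1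
      have hb : (fun n => (r + 1) * M n 2 * M n r) =O[atTop] fun _ => (1 : ℝ) := by
        simpa using (h2.const_mul_left ((r : ℂ) + 1)).mul (ih r (by omega)).1
      constructor
      · simpa using hdiff.isBigO.add hb
      · have h := (h2.const_mul_left ((r : ℂ) + 1)).mul_isLittleO (ih r (by omega)).2
        simp only [mul_one] at h
        refine (hdiff.add h).congr_left fun n => ?_
        rw [gaussianMoment]
        ring

/-- The **method of moments**: if the cumulants of order at least three of centred random variables
with bounded variances tend to zero, then the characteristic functions approach those of the
centred Gaussian distributions with the same variances. -/
theorem tendsto_charFun_sub_exp {Ω : Type*} [MeasurableSpace Ω] (P : Measure Ω)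
    [IsProbabilityMeasure P] {X : ℕ → Ω → ℝ} (hX : ∀ n r, Integrable (fun ω => X n ω ^ r) P)
    (h1 : ∀ n, ∫ ω, X n ω ∂P = 0) {V : ℝ} (h2 : ∀ n, ∫ ω, X n ω ^ 2 ∂P ≤ V)
    (h3 : ∀ r, 3 ≤ r → Tendsto
      (fun n => momentCumulant (fun k => ((∫ ω, X n ω ^ k ∂P : ℝ) : ℂ)) r) atTop (𝓝 0)) (t : ℝ) :
    Tendsto (fun n => (∫ ω, Complex.exp (t * X n ω * Complex.I) ∂P) -
      Complex.exp (-(t ^ 2 * (∫ ω, X n ω ^ 2 ∂P : ℝ) / 2))) atTop (𝓝 0) := by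
  set M : ℕ → ℕ → ℂ := fun n k => ((∫ ω, X n ω ^ k ∂P : ℝ) : ℂ) with hM
  have hv0 : ∀ n, 0 ≤ ∫ ω, X n ω ^ 2 ∂P := fun n => integral_nonneg fun ω => sq_nonneg _
  have hV : 0 ≤ V := (hv0 0).trans (h2 0)
  have hmom := isLittleO_moment_sub_gaussianMoment (M := M) (by simp [hM])
    (by simp [hM, h1]) (by
      refine Asymptotics.IsBigO.of_bound V (Eventually.of_forall fun n => ?_)
      simp only [hM, Complex.norm_real, norm_one, mul_one, Real.norm_eq_abs, abs_of_nonneg (hv0 n)]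
      exact h2 n)
    (fun r hr => (Asymptotics.isLittleO_one_iff ℝ).2 (h3 r hr))
  have hg : ∀ r, Tendsto (fun n => M n r - gaussianMoment (M n 2) r) atTop (𝓝 0) := fun r =>
    (Asymptotics.isLittleO_one_iff ℝ).1 (hmom r).2
  -- Both exponentials are expanded, to `2m` and `m` terms. One copy of the first summand bounds the
  -- Gaussian remainder; the other bounds the Gaussian part of the moment of order `2m` in the
  -- remainder for `X n`. The index `k = 2m` in the sum accounts for the rest of that moment.
  have hmain : ∀ m n, ‖(∫ ω, Complex.exp (t * X n ω * Complex.I) ∂P) -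
      Complex.exp (-(t ^ 2 * (∫ ω, X n ω ^ 2 ∂P : ℝ) / 2))‖ ≤
      2 * ((t ^ 2 * V / 2) ^ m / (m.factorial : ℝ)) +
      ∑ k ∈ Finset.range (2 * m + 1), |t| ^ k / (k.factorial : ℝ) *
        ‖M n k - gaussianMoment (M n 2) k‖ := by
    intro m n
    have hmeas : AEStronglyMeasurable (X n) P := by simpa using (hX n 1).aestronglyMeasurable
    have hint : Integrable (fun ω => Complex.exp (t * X n ω * Complex.I)) P := by
      refine Integrable.of_bound (C := 1) ?_ (Eventually.of_forall fun ω => ?_)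
      · exact (by fun_prop : Continuous fun x : ℝ =>
          Complex.exp (t * x * Complex.I)).comp_aestronglyMeasurable hmeas
      · rw [← Complex.ofReal_mul, Complex.norm_exp_ofReal_mul_I]
    have hintk : ∀ k, Integrable (fun ω => (t * X n ω * Complex.I) ^ k / (k.factorial : ℂ)) P := by
      intro k
      have := ((hX n k).ofReal (𝕜 := ℂ)).const_mul ((t * Complex.I) ^ k / (k.factorial : ℂ))
      refine this.congr (Eventually.of_forall fun ω => ?_)
      simp only [RCLike.ofReal_pow, Complex.coe_algebraMap]
      simp [mul_pow]
      ring
    have hintegral : ∀ k, ∫ ω, (t * X n ω * Complex.I) ^ k / (k.factorial : ℂ) ∂P =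
        (t * Complex.I) ^ k / (k.factorial : ℂ) * M n k := by
      intro k
      simp only [hM]
      rw [← integral_complex_ofReal, ← integral_const_mul]
      refine integral_congr_ae (Eventually.of_forall fun ω => ?_)
      simp only
      push_cast
      ring
    have hA : ‖(∫ ω, Complex.exp (t * X n ω * Complex.I) ∂P) -
        ∑ k ∈ Finset.range (2 * m), (t * Complex.I) ^ k / (k.factorial : ℂ) * M n k‖ ≤
        |t| ^ (2 * m) / ((2 * m).factorial : ℝ) * ‖M n (2 * m)‖ := by
      simp only [← hintegral]
      rw [← integral_finsetSum _ (fun k _ => hintk k),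
        ← integral_sub hint (integrable_finsetSum _ fun k _ => hintk k)]
      refine (norm_integral_le_integral_norm _).trans ?_
      have hMn : ‖M n (2 * m)‖ = ∫ ω, X n ω ^ (2 * m) ∂P := by
        simp only [hM, Complex.norm_real]
        exact Real.norm_of_nonneg (integral_nonneg fun ω => (even_two_mul m).pow_nonneg _)
      rw [hMn, ← integral_const_mul]
      refine integral_mono_of_nonneg (Eventually.of_forall fun ω => norm_nonneg _)
        ((hX n (2 * m)).const_mul _) (Eventually.of_forall fun ω => ?_)
      refine (norm_exp_sub_sum_le (by simp) (2 * m)).trans (le_of_eq ?_)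
      rw [norm_mul, norm_mul, Complex.norm_I, mul_one, Complex.norm_real, Complex.norm_real,
        mul_pow,
        Real.norm_eq_abs, Real.norm_eq_abs, (even_two_mul m).pow_abs (X n ω)]
      ring
    have hB : ‖∑ k ∈ Finset.range (2 * m), (t * Complex.I) ^ k / (k.factorial : ℂ) * M n k -
        ∑ k ∈ Finset.range (2 * m), (t * Complex.I) ^ k / (k.factorial : ℂ) *
          gaussianMoment (M n 2) k‖ ≤
        ∑ k ∈ Finset.range (2 * m), |t| ^ k / (k.factorial : ℝ) *
          ‖M n k - gaussianMoment (M n 2) k‖ := by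
      rw [← Finset.sum_sub_distrib]
      refine (norm_sum_le _ _).trans (Finset.sum_le_sum fun k _ => le_of_eq ?_)
      rw [← mul_sub, norm_mul, norm_div, norm_pow, norm_mul, Complex.norm_I, mul_one,
        Complex.norm_real, Real.norm_eq_abs, Complex.norm_natCast]
    have hnM : ‖M n 2‖ ≤ V := by
      simp only [hM, Complex.norm_real]
      rw [Real.norm_of_nonneg (hv0 n)]
      exact h2 n
    have hpow : ‖t ^ 2 * M n 2 / 2‖ ^ m / (m.factorial : ℝ) ≤
        (t ^ 2 * V / 2) ^ m / (m.factorial : ℝ) := by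
      have : ‖t ^ 2 * M n 2 / 2‖ ≤ t ^ 2 * V / 2 := by
        rw [norm_div, norm_mul, norm_pow, Complex.norm_real, Real.norm_eq_abs, sq_abs,
          Complex.norm_two]
        gcongr
      gcongr
    have hC : ‖∑ k ∈ Finset.range (2 * m), (t * Complex.I) ^ k / (k.factorial : ℂ) *
          gaussianMoment (M n 2) k - Complex.exp (-(t ^ 2 * (∫ ω, X n ω ^ 2 ∂P : ℝ) / 2))‖ ≤
        (t ^ 2 * V / 2) ^ m / (m.factorial : ℝ) := by
      rw [sum_gaussianMoment, norm_sub_rev]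
      have h := norm_exp_sub_sum_le (z := -(t ^ 2 * M n 2 / 2)) (by
        simp only [hM]
        norm_cast
        have := hv0 n
        have : 0 ≤ t ^ 2 * (∫ ω, X n ω ^ 2 ∂P) / 2 := by positivity
        linarith) m
      rw [norm_neg] at h
      refine (le_of_eq ?_).trans (h.trans hpow)
      congr 2
      refine Finset.sum_congr rfl fun k _ => ?_
      rw [mul_pow, Complex.I_sq]
      ring
    have hD : |t| ^ (2 * m) / ((2 * m).factorial : ℝ) * ‖M n (2 * m)‖ ≤
        |t| ^ (2 * m) / ((2 * m).factorial : ℝ) *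
          ‖M n (2 * m) - gaussianMoment (M n 2) (2 * m)‖ +
        (t ^ 2 * V / 2) ^ m / (m.factorial : ℝ) := by
      have hg2 : |t| ^ (2 * m) / ((2 * m).factorial : ℝ) * ‖gaussianMoment (M n 2) (2 * m)‖ ≤
          (t ^ 2 * V / 2) ^ m / (m.factorial : ℝ) := by
        refine (le_of_eq ?_).trans hpow
        have h := congrArg norm (gaussianMoment_even_div (M n 2) m)
        rw [norm_div, norm_div, Complex.norm_natCast, Complex.norm_natCast, norm_pow] at h
        rw [div_mul_eq_mul_div, mul_div_assoc, h, mul_div_assoc, norm_mul, mul_pow, pow_mul, sq_abs,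
          norm_pow, Complex.norm_real, Real.norm_eq_abs, sq_abs, mul_div_assoc]
      have htri : ‖M n (2 * m)‖ ≤ ‖M n (2 * m) - gaussianMoment (M n 2) (2 * m)‖ +
          ‖gaussianMoment (M n 2) (2 * m)‖ := by
        simpa using norm_add_le (M n (2 * m) - gaussianMoment (M n 2) (2 * m))
          (gaussianMoment (M n 2) (2 * m))
      calc _ ≤ |t| ^ (2 * m) / ((2 * m).factorial : ℝ) *
            (‖M n (2 * m) - gaussianMoment (M n 2) (2 * m)‖ +
          ‖gaussianMoment (M n 2) (2 * m)‖) := by gcongr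
        _ ≤ _ := by rw [mul_add]; gcongr
    rw [Finset.sum_range_succ]
    have htri := (norm_sub_le_norm_sub_add_norm_sub (∫ ω, Complex.exp (t * X n ω * Complex.I) ∂P)
      (∑ k ∈ Finset.range (2 * m), (t * Complex.I) ^ k / (k.factorial : ℂ) * M n k)
      (Complex.exp (-(t ^ 2 * (∫ ω, X n ω ^ 2 ∂P : ℝ) / 2)))).trans
      (add_le_add_right (norm_sub_le_norm_sub_add_norm_sub _ (∑ k ∈ Finset.range (2 * m),
        (t * Complex.I) ^ k / (k.factorial : ℂ) * gaussianMoment (M n 2) k) _) _)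
    linarith
  rw [Metric.tendsto_atTop]
  intro ε hε
  have hfac : Tendsto (fun m : ℕ => 2 * ((t ^ 2 * V / 2) ^ m / (m.factorial : ℝ))) atTop (𝓝 0) := by
    have h := (FloorSemiring.tendsto_pow_div_factorial_atTop (t ^ 2 * V / 2)).const_mul 2
    rwa [mul_zero] at h
  -- The order `m` depends on `ε`, `t` and `V` alone, so it is fixed before `n` grows.
  obtain ⟨m, hm⟩ := ((tendsto_order.1 hfac).2 (ε / 2) (half_pos hε)).exists
  have hsum : Tendsto (fun n => ∑ k ∈ Finset.range (2 * m + 1), |t| ^ k / (k.factorial : ℝ) *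
      ‖M n k - gaussianMoment (M n 2) k‖) atTop (𝓝 0) := by
    simpa using tendsto_finsetSum (Finset.range (2 * m + 1)) fun k _ =>
      ((hg k).norm.const_mul (|t| ^ k / (k.factorial : ℝ)))
  obtain ⟨N, hN⟩ := eventually_atTop.1 ((tendsto_order.1 hsum).2 (ε / 2) (half_pos hε))
  refine ⟨N, fun n hn => ?_⟩
  rw [dist_zero_right]
  have := hmain m n
  have := hN n hn
  linarith


/-! ### Cumulants as multilinear maps -/

section Cumulant

variable {G : Type*} [TopologicalSpace G] [CompactSpace G] [MeasurableSpace G]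

omit [TopologicalSpace G] [CompactSpace G] in
lemma cumulant_const [CommGroup G] (μ : Measure G) (X : G → ℂ) (r : ℕ) :
    cumulant μ (fun _ : Fin r => X) = momentCumulant (fun k => ∫ x, X x ^ k ∂μ) r := by
  simp [cumulant, momentCumulant, setCumulant, cumulantCoeff]

variable [BorelSpace G]

lemma integrable_continuousMap (μ : Measure G) [IsFiniteMeasure μ] (g : C(G, ℂ)) :
    Integrable g μ :=
  g.continuous.integrable_of_hasCompactSupport (HasCompactSupport.of_compactSpace _)

omit [CompactSpace G] [BorelSpace G] in
-- Only the block containing `i` sees the updated variable, and it does so linearly; this gives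
-- multilinearity.
lemma prod_integral_update (μ : Measure G) {r : ℕ} (X : Fin r → C(G, ℂ)) (i : Fin r) (z : C(G, ℂ))
    (π : Finpartition (Finset.univ : Finset (Fin r))) :
    ∏ I ∈ π.parts, ∫ x, ∏ j ∈ I, Function.update X i z j x ∂μ =
      (∫ x, z x * ∏ j ∈ (π.part i).erase i, X j x ∂μ) *
        ∏ I ∈ π.parts.erase (π.part i), ∫ x, ∏ j ∈ I, X j x ∂μ := by
  have hpart : π.part i ∈ π.parts := π.part_mem.2 (Finset.mem_univ i)
  have hi : i ∈ π.part i := π.mem_part (Finset.mem_univ i)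
  rw [← Finset.mul_prod_erase _ _ hpart]
  congr 1
  · refine integral_congr_ae (Eventually.of_forall fun x => ?_)
    simp only
    rw [← Finset.mul_prod_erase _ _ hi, Function.update_self]
    congr 1
    refine Finset.prod_congr rfl fun j hj => ?_
    rw [Function.update_of_ne (Finset.ne_of_mem_erase hj)]
  · refine Finset.prod_congr rfl fun I hI => ?_
    have hiI : i ∉ I := fun h => Finset.ne_of_mem_erase hI
      (π.part_eq_of_mem (Finset.mem_of_mem_erase hI) h).symm
    refine integral_congr_ae (Eventually.of_forall fun x => ?_)
    refine Finset.prod_congr rfl fun j hj => ?_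
    rw [Function.update_of_ne (by rintro rfl; exact hiI hj)]

/-- The summand of a partition in a cumulant as a multilinear map on continuous functions. -/
def prodIntegral (μ : Measure G) [IsFiniteMeasure μ] {r : ℕ}
    (π : Finpartition (Finset.univ : Finset (Fin r))) :
    MultilinearMap ℂ (fun _ : Fin r => C(G, ℂ)) ℂ where
  toFun X := ∏ I ∈ π.parts, ∫ x, ∏ j ∈ I, X j x ∂μ
  map_update_add' {dec} X i y z := by
    obtain rfl : dec = instDecidableEqFin r := Subsingleton.elim _ _
    have hint : ∀ y : C(G, ℂ),
        Integrable (fun x => y x * ∏ j ∈ (π.part i).erase i, X j x) μ := fun y => by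
      refine (integrable_continuousMap μ (y * ∏ j ∈ (π.part i).erase i, X j)).congr
        (Eventually.of_forall fun x => ?_)
      rw [ContinuousMap.mul_apply, ContinuousMap.prod_apply]
    have h : ∫ x, (y + z) x * ∏ j ∈ (π.part i).erase i, X j x ∂μ =
        ∫ x, y x * ∏ j ∈ (π.part i).erase i, X j x ∂μ +
          ∫ x, z x * ∏ j ∈ (π.part i).erase i, X j x ∂μ := by
      rw [← integral_add (hint y) (hint z)]
      simp only [ContinuousMap.add_apply, add_mul]
    rw [prod_integral_update, prod_integral_update, prod_integral_update, h, add_mul]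
  map_update_smul' {dec} X i c z := by
    obtain rfl : dec = instDecidableEqFin r := Subsingleton.elim _ _
    have h : ∫ x, (c • z) x * ∏ j ∈ (π.part i).erase i, X j x ∂μ =
        c * ∫ x, z x * ∏ j ∈ (π.part i).erase i, X j x ∂μ := by
      rw [← integral_const_mul]
      simp only [ContinuousMap.smul_apply, smul_eq_mul, mul_assoc]
    rw [prod_integral_update, prod_integral_update, h, smul_eq_mul, mul_assoc]

/-- The cumulant as a multilinear map on continuous functions. -/
def cumulantMultilinear (μ : Measure G) [IsFiniteMeasure μ] (r : ℕ) :
    MultilinearMap ℂ (fun _ : Fin r => C(G, ℂ)) ℂ :=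
  ∑ π : Finpartition (Finset.univ : Finset (Fin r)),
    ((-1 : ℂ) ^ (π.parts.card - 1) * ((π.parts.card - 1).factorial : ℂ)) • prodIntegral μ π

lemma cumulantMultilinear_apply [CommGroup G] (μ : Measure G) [IsFiniteMeasure μ] {r : ℕ}
    (X : Fin r → C(G, ℂ)) : cumulantMultilinear μ r X = cumulant μ fun j x => X j x := by
  rw [cumulantMultilinear, sum_apply]
  rfl

/-- A bound for the cumulants of order `r` of random variables bounded by `1`. -/
def cumulantBound (r : ℕ) : ℝ :=
  ∑ π : Finpartition (Finset.univ : Finset (Fin r)), ((π.parts.card - 1).factorial : ℝ)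

lemma cumulantBound_nonneg (r : ℕ) : 0 ≤ cumulantBound r :=
  Finset.sum_nonneg fun _ _ => by positivity

omit [TopologicalSpace G] [CompactSpace G] [BorelSpace G] in
lemma norm_cumulant_le [CommGroup G] (μ : Measure G) [IsProbabilityMeasure μ] {r : ℕ}
    {X : Fin r → G → ℂ} (hX : ∀ j x, ‖X j x‖ ≤ 1) : ‖cumulant μ X‖ ≤ cumulantBound r := by
  refine (norm_sum_le _ _).trans (Finset.sum_le_sum fun π _ => ?_)
  rw [norm_mul, norm_mul, norm_pow, norm_neg, norm_one, one_pow, one_mul, Complex.norm_natCast,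
    norm_prod]
  refine mul_le_of_le_one_right (by positivity) (Finset.prod_le_one (fun _ _ => norm_nonneg _) ?_)
  intro I _
  refine (norm_integral_le_of_norm_le_const (C := 1) (Eventually.of_forall fun x => ?_)).trans
    (by simp)
  rw [norm_prod]
  exact Finset.prod_le_one (fun _ _ => norm_nonneg _) fun j _ => hX j x

lemma cumulantMultilinear_sum_smul (μ : Measure G) [IsFiniteMeasure μ] {r : ℕ}
    {ι : Type*} (S : Finset ι) (a : ι → ℂ) (Y : Fin r → ι → C(G, ℂ)) :
    cumulantMultilinear μ r (fun j => ∑ i ∈ S, a i • Y j i) =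
      ∑ k ∈ Fintype.piFinset fun _ : Fin r => S,
        (∏ j, a (k j)) * cumulantMultilinear μ r fun j => Y j (k j) := by
  rw [MultilinearMap.map_sum_finset]
  refine Finset.sum_congr rfl fun k _ => ?_
  rw [MultilinearMap.map_smul_univ, smul_eq_mul]

end Cumulant

/-! ### Trigonometric polynomials and the mixing hypothesis -/

section Characters

variable {d : ℕ} {G : Type*} [CommGroup G] [TopologicalSpace G]

/-- A character as a complex continuous function. -/
def charMap (χ : PontryaginDual G) : C(G, ℂ) := ⟨fun x => (χ x : ℂ), by fun_prop⟩

@[simp] lemma charMap_apply (χ : PontryaginDual G) (x : G) : charMap χ x = (χ x : ℂ) := rfl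

/-- The automorphism `T^ℓ` as a continuous map. -/
def actMap {T : Multiplicative (Fin d → ℤ) →* MulAut G} (hT : ∀ ℓ, Continuous (act T ℓ))
    (ℓ : Fin d → ℤ) : C(G, G) := ⟨act T ℓ, hT ℓ⟩

@[simp] lemma actMap_apply {T : Multiplicative (Fin d → ℤ) →* MulAut G}
    (hT : ∀ ℓ, Continuous (act T ℓ)) (ℓ : Fin d → ℤ) (x : G) : actMap hT ℓ x = act T ℓ x := rfl

/-- The trigonometric polynomial `∑_{χ ∈ Φ} c(χ) χ`. -/
def trigPoly (Φ : Finset (PontryaginDual G)) (c : PontryaginDual G → ℂ) : C(G, ℂ) :=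
  ∑ χ ∈ Φ, c χ • charMap χ

variable [CompactSpace G] [MeasurableSpace G] [BorelSpace G]
  (μ : Measure G) [IsProbabilityMeasure μ]
  {T : Multiplicative (Fin d → ℤ) →* MulAut G}

/-- Expanding in characters gives cumulants of tuples from `Φ`: all vanish off the non-mixing set by
its definition, and each is at most `cumulantBound r` since characters have modulus one. -/
lemma norm_cumulant_trigPoly_le (hT : ∀ ℓ, Continuous (act T ℓ))
    (Φ : Finset (PontryaginDual G)) (c : PontryaginDual G → ℂ) {r : ℕ}
    (a : Fin r → Fin d → ℤ) :
    ‖cumulantMultilinear μ r fun j => (trigPoly Φ c).comp (actMap hT (a j))‖ ≤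
      (nonMixing T μ Φ r).indicator (fun _ => cumulantBound r * (∑ χ ∈ Φ, ‖c χ‖) ^ r) a := by
  have hexp : ∀ j, (trigPoly Φ c).comp (actMap hT (a j)) =
      ∑ χ ∈ Φ, c χ • (charMap χ).comp (actMap hT (a j)) := by
    intro j
    ext x
    simp [trigPoly]
  simp only [hexp]
  rw [cumulantMultilinear_sum_smul]
  by_cases ha : a ∈ nonMixing T μ Φ r
  · rw [Set.indicator_of_mem ha, Finset.sum_pow', Finset.mul_sum]
    refine (norm_sum_le _ _).trans (Finset.sum_le_sum fun k _ => ?_)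
    rw [norm_mul, mul_comm, norm_prod]
    refine mul_le_mul_of_nonneg_right ?_ (Finset.prod_nonneg fun _ _ => norm_nonneg _)
    rw [cumulantMultilinear_apply]
    exact norm_cumulant_le μ fun j x => (Circle.norm_coe _).le
  · rw [Set.indicator_of_notMem ha]
    refine le_of_eq (norm_eq_zero.2 (Finset.sum_eq_zero fun k hk => ?_))
    have : cumulantMultilinear μ r (fun j => (charMap (k j)).comp (actMap hT (a j))) = 0 := by
      by_contra hne
      rw [cumulantMultilinear_apply] at hne
      exact ha ⟨k, fun j => Fintype.mem_piFinset.1 hk j, hne⟩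
    rw [this, mul_zero]

/-- Without summability, the series over non-mixing tuples would have the default value `0` and
bound nothing. -/
lemma summable_prod_apply {ι : Type*} {u : ι → ℝ} (h0 : ∀ i, 0 ≤ u i) (hu : Summable u) (r : ℕ) :
    Summable fun a : Fin r → ι => ∏ j, u (a j) := by
  classical
  refine summable_of_sum_le (c := (∑' i, u i) ^ r) (fun a => Finset.prod_nonneg fun j _ => h0 _)
    fun S => ?_
  let F : Finset ι := Finset.univ.biUnion fun j => S.image fun a => a j
  have hS : S ⊆ Fintype.piFinset fun _ : Fin r => F := by
    intro a ha
    rw [Fintype.mem_piFinset]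
    intro j
    exact Finset.mem_biUnion.2 ⟨j, Finset.mem_univ j, Finset.mem_image_of_mem _ ha⟩
  calc ∑ a ∈ S, ∏ j, u (a j) ≤ ∑ a ∈ Fintype.piFinset fun _ : Fin r => F, ∏ j, u (a j) :=
        Finset.sum_le_sum_of_subset_of_nonneg hS fun _ _ _ => Finset.prod_nonneg fun j _ => h0 _
    _ = (∑ i ∈ F, u i) ^ r := by rw [Finset.sum_pow']
    _ ≤ _ := by
      have := hu.sum_le_tsum F fun i _ => h0 i
      have := Finset.sum_nonneg fun i (_ : i ∈ F) => h0 i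
      gcongr

/-- The point where the mixing hypothesis meets the cumulants. The bound does not depend on `F`,
which leaves the truncation of the weights free. -/
lemma norm_momentCumulant_sum_le (hT : ∀ ℓ, Continuous (act T ℓ))
    (Φ : Finset (PontryaginDual G)) (c : PontryaginDual G → ℂ)
    {u : (Fin d → ℤ) → ℝ} (h0 : ∀ ℓ, 0 ≤ u ℓ) (hu : Summable u) (F : Finset (Fin d → ℤ)) (r : ℕ) :
    ‖momentCumulant (fun k => ∫ x, (∑ ℓ ∈ F, (u ℓ : ℂ) * trigPoly Φ c (act T ℓ x)) ^ k ∂μ) r‖ ≤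
      cumulantBound r * (∑ χ ∈ Φ, ‖c χ‖) ^ r * ∑' a : nonMixing T μ Φ r, ∏ j, u (a.1 j) := by
  rw [← cumulant_const]
  have heq : cumulant μ (fun _ : Fin r => fun x => ∑ ℓ ∈ F, (u ℓ : ℂ) * trigPoly Φ c (act T ℓ x)) =
      cumulantMultilinear μ r fun _ => ∑ ℓ ∈ F, (u ℓ : ℂ) • (trigPoly Φ c).comp (actMap hT ℓ) := by
    rw [cumulantMultilinear_apply]
    congr 1
    ext j x
    simp
  rw [heq, cumulantMultilinear_sum_smul μ F (fun ℓ => (u ℓ : ℂ))]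
  have hsum := summable_prod_apply h0 hu r
  have hpos : 0 ≤ cumulantBound r * (∑ χ ∈ Φ, ‖c χ‖) ^ r :=
    mul_nonneg (cumulantBound_nonneg r) (pow_nonneg (Finset.sum_nonneg fun _ _ => norm_nonneg _) _)
  calc _ ≤ ∑ k ∈ Fintype.piFinset fun _ : Fin r => F, cumulantBound r * (∑ χ ∈ Φ, ‖c χ‖) ^ r *
          (nonMixing T μ Φ r).indicator (fun a => ∏ j, u (a j)) k := by
        refine (norm_sum_le _ _).trans (Finset.sum_le_sum fun k _ => ?_)
        rw [norm_mul, norm_prod]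
        simp only [Complex.norm_real, Real.norm_of_nonneg (h0 _)]
        refine (mul_le_mul_of_nonneg_left (norm_cumulant_trigPoly_le μ hT Φ c k)
          (Finset.prod_nonneg fun j _ => h0 _)).trans (le_of_eq ?_)
        by_cases hk : k ∈ nonMixing T μ Φ r
        · simp only [Set.indicator_of_mem hk, mul_comm]
        · simp only [Set.indicator_of_notMem hk, mul_zero]
    _ ≤ _ := by
      rw [← Finset.mul_sum]
      refine mul_le_mul_of_nonneg_left ?_ hpos
      rw [tsum_subtype (nonMixing T μ Φ r) fun a => ∏ j, u (a j)]
      exact (hsum.indicator _).sum_le_tsum _ fun a _ =>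
        Set.indicator_nonneg (fun a _ => Finset.prod_nonneg fun j _ => h0 _) a

end Characters


/-! ### Orbits of characters -/

section Orbits

variable {d : ℕ} {G : Type*} [CommGroup G] [TopologicalSpace G]
  {T : Multiplicative (Fin d → ℤ) →* MulAut G}

omit [TopologicalSpace G] in
lemma act_add (a b : Fin d → ℤ) (x : G) : act T (a + b) x = act T a (act T b x) := by
  simp [act, ofAdd_add]

omit [TopologicalSpace G] in
lemma act_zero (x : G) : act T 0 x = x := by
  simp [act]

/-- The dual automorphism `χ ↦ χ ∘ T^ℓ` of the group of characters. -/
def dualAct (hT : ∀ ℓ, Continuous (act T ℓ)) (ℓ : Fin d → ℤ) (χ : PontryaginDual G) :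
    PontryaginDual G :=
  PontryaginDual.map ⟨(T (Multiplicative.ofAdd ℓ)).toMonoidHom, hT ℓ⟩ χ

@[simp] lemma dualAct_apply (hT : ∀ ℓ, Continuous (act T ℓ)) (ℓ : Fin d → ℤ)
    (χ : PontryaginDual G) (x : G) : dualAct hT ℓ χ x = χ (act T ℓ x) := rfl

lemma dualAct_add (hT : ∀ ℓ, Continuous (act T ℓ)) (a b : Fin d → ℤ) (χ : PontryaginDual G) :
    dualAct hT (a + b) χ = dualAct hT b (dualAct hT a χ) := by
  ext x
  simp [act_add]

lemma dualAct_zero (hT : ∀ ℓ, Continuous (act T ℓ)) (χ : PontryaginDual G) :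
    dualAct hT 0 χ = χ := by
  ext x
  simp [act_zero]

lemma dualAct_one (hT : ∀ ℓ, Continuous (act T ℓ)) (ℓ : Fin d → ℤ) : dualAct hT ℓ 1 = 1 := by
  ext x
  simp

lemma dualAct_ne_one (hT : ∀ ℓ, Continuous (act T ℓ)) (ℓ : Fin d → ℤ) {χ : PontryaginDual G}
    (hχ : χ ≠ 1) : dualAct hT ℓ χ ≠ 1 := by
  intro h
  apply hχ
  rw [← dualAct_zero hT χ, ← add_neg_cancel ℓ, dualAct_add, h, dualAct_one]

lemma charMap_comp_actMap (hT : ∀ ℓ, Continuous (act T ℓ)) (ℓ : Fin d → ℤ)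
    (χ : PontryaginDual G) : (charMap χ).comp (actMap hT ℓ) = charMap (dualAct hT ℓ χ) := rfl

variable [IsTopologicalGroup G] [CompactSpace G] [MeasurableSpace G] [BorelSpace G]
  (μ : Measure G) [μ.IsHaarMeasure] [IsProbabilityMeasure μ]

omit [IsTopologicalGroup G] [CompactSpace G] [BorelSpace G] [TopologicalSpace G] in
lemma measurePreserving_act {μ : Measure G} (hTerg : IsTotallyErgodic T μ) (ℓ : Fin d → ℤ) :
    MeasurePreserving (act T ℓ) μ μ := by
  by_cases h : ℓ = 0
  · subst h
    have : act T 0 = id := funext act_zero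
    rw [this]
    exact MeasurePreserving.id μ
  · exact (hTerg ℓ h).toMeasurePreserving

omit [IsTopologicalGroup G] [CompactSpace G] in
lemma integral_comp_act {μ : Measure G} (hT : ∀ ℓ, Continuous (act T ℓ))
    (hTerg : IsTotallyErgodic T μ) {E : Type*} [NormedAddCommGroup E] [NormedSpace ℝ E]
    [SecondCountableTopology E] [MeasurableSpace E] [BorelSpace E]
    (ℓ : Fin d → ℤ) {g : G → E} (hg : Continuous g) :
    ∫ x, g (act T ℓ x) ∂μ = ∫ x, g x ∂μ := by
  have h := measurePreserving_act hTerg ℓ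
  conv_rhs => rw [← h.map_eq]
  exact (integral_map (hT ℓ).measurable.aemeasurable hg.measurable.aestronglyMeasurable).symm

omit [IsTopologicalGroup G] [CompactSpace G] [IsProbabilityMeasure μ] in
-- A fixed character is an invariant function, hence almost everywhere constant; as Haar measure
-- charges open sets it is constant everywhere, with its value `1` at the identity.
lemma dualAct_ne_self (hT : ∀ ℓ, Continuous (act T ℓ)) (hTerg : IsTotallyErgodic T μ)
    {ℓ : Fin d → ℤ} (hℓ : ℓ ≠ 0) {χ : PontryaginDual G} (hχ : χ ≠ 1) : dualAct hT ℓ χ ≠ χ := by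
  intro h
  apply hχ
  have hinv : (charMap χ : G → ℂ) ∘ act T ℓ = charMap χ := by
    ext x
    exact congrArg (fun ψ : PontryaginDual G => (ψ x : ℂ)) h
  obtain ⟨c, hc⟩ := (hTerg ℓ hℓ).toPreErgodic.ae_eq_const_of_ae_eq_comp
    (charMap χ).continuous.measurable hinv
  have hconst : (charMap χ : G → ℂ) = Function.const G c :=
    (charMap χ).continuous.ae_eq_iff_eq μ continuous_const |>.1 hc
  ext x
  have h1 := congrFun hconst x
  have h2 := congrFun hconst 1
  simp only [charMap_apply, Function.const_apply, map_one, Circle.coe_one] at h1 h2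
  rw [h1, ← h2]
  simp

omit [IsTopologicalGroup G] [CompactSpace G] [IsProbabilityMeasure μ] in
lemma dualAct_injective (hT : ∀ ℓ, Continuous (act T ℓ)) (hTerg : IsTotallyErgodic T μ)
    {χ : PontryaginDual G} (hχ : χ ≠ 1) : Function.Injective fun ℓ => dualAct hT ℓ χ := by
  intro a b h
  by_contra hab
  refine dualAct_ne_self μ hT hTerg (sub_ne_zero.2 hab) hχ ?_
  simp only at h
  rw [sub_eq_add_neg, dualAct_add, h, ← dualAct_add, add_neg_cancel, dualAct_zero]

omit [CompactSpace G] [IsProbabilityMeasure μ] in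
lemma integral_charMap {χ : PontryaginDual G} (hχ : χ ≠ 1) : ∫ x, charMap χ x ∂μ = 0 := by
  obtain ⟨y, hy⟩ : ∃ y, χ y ≠ 1 := by
    by_contra! h
    exact hχ (PontryaginDual.ext h)
  have h1 : ∫ x, charMap χ (y * x) ∂μ = ∫ x, charMap χ x ∂μ := integral_mul_left_eq_self _ y
  simp only [charMap_apply, map_mul, Circle.coe_mul, integral_const_mul] at h1 ⊢
  have h2 : ((χ y : ℂ) - 1) * ∫ x, (χ x : ℂ) ∂μ = 0 := by rw [sub_mul, h1, one_mul, sub_self]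
  refine (mul_eq_zero.1 h2).resolve_left (sub_ne_zero.2 fun h => hy ?_)
  exact Circle.ext (by simpa using h)

/-- The embedding of the continuous functions into `L²`. -/
abbrev toL2 : C(G, ℂ) →L[ℂ] Lp ℂ 2 μ := ContinuousMap.toLp (E := ℂ) 2 μ ℂ

lemma orthonormal_charMap : Orthonormal ℂ fun χ : PontryaginDual G => toL2 μ (charMap χ) := by
  classical
  rw [orthonormal_iff_ite]
  intro χ ψ
  rw [ContinuousMap.inner_toLp]
  have heq : ∀ x, charMap ψ x * (starRingEnd ℂ) (charMap χ x) = charMap (ψ * χ⁻¹) x := by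
    intro x
    have : (χ⁻¹ : PontryaginDual G) x = (χ x)⁻¹ := rfl
    have h2 : (ψ * χ⁻¹ : PontryaginDual G) x = ψ x * (χ⁻¹ : PontryaginDual G) x := rfl
    rw [charMap_apply, charMap_apply, charMap_apply, h2, this, Circle.coe_mul,
      Circle.coe_inv_eq_conj]
  simp only [heq]
  split_ifs with h
  · subst h
    simp
  · exact integral_charMap μ fun h' => h (mul_inv_eq_one.1 h').symm

lemma norm_toL2_sum_charMap (hT : ∀ ℓ, Continuous (act T ℓ)) (hTerg : IsTotallyErgodic T μ)
    {χ : PontryaginDual G} (hχ : χ ≠ 1) (u : (Fin d → ℤ) → ℝ) (F : Finset (Fin d → ℤ)) :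
    ‖toL2 μ (∑ ℓ ∈ F, (u ℓ : ℂ) • (charMap χ).comp (actMap hT ℓ))‖ = √(∑ ℓ ∈ F, u ℓ ^ 2) := by
  have ho : Orthonormal ℂ fun ℓ => toL2 μ (charMap (dualAct hT ℓ χ)) :=
    (orthonormal_charMap μ).comp _ (dualAct_injective μ hT hTerg hχ)
  have h := ho.inner_sum (fun ℓ => (u ℓ : ℂ)) (fun ℓ => (u ℓ : ℂ)) F
  simp only [map_sum, map_smul, charMap_comp_actMap]
  rw [inner_self_eq_norm_sq_to_K] at h
  rw [← Real.sqrt_sq (norm_nonneg (∑ ℓ ∈ F, (u ℓ : ℂ) • toL2 μ (charMap (dualAct hT ℓ χ))))]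
  congr 1
  apply Complex.ofReal_injective
  push_cast
  refine Eq.trans h ?_
  refine Finset.sum_congr rfl fun ℓ _ => ?_
  rw [Complex.conj_ofReal, sq]

/-- Pythagoras along each orbit, then the triangle inequality over the characters. The trivial
character must be absent, its orbit being a single point. -/
lemma norm_toL2_sum_le (hT : ∀ ℓ, Continuous (act T ℓ)) (hTerg : IsTotallyErgodic T μ)
    {c : PontryaginDual G → ℂ} (hc : Summable fun χ => ‖c χ‖) (hc1 : c 1 = 0) {h : C(G, ℂ)}
    (hh : HasSum (fun χ => c χ • charMap χ) h) (u : (Fin d → ℤ) → ℝ) (F : Finset (Fin d → ℤ)) :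
    ‖toL2 μ (∑ ℓ ∈ F, (u ℓ : ℂ) • h.comp (actMap hT ℓ))‖ ≤
      (∑' χ, ‖c χ‖) * √(∑ ℓ ∈ F, u ℓ ^ 2) := by
  let L : C(G, ℂ) →L[ℂ] C(G, ℂ) :=
    { toFun := fun g => ∑ ℓ ∈ F, (u ℓ : ℂ) • g.comp (actMap hT ℓ)
      map_add' := fun g k => by
        simp only [← Finset.sum_add_distrib, ← smul_add]
        rfl
      map_smul' := fun a g => by
        rw [RingHom.id_apply, Finset.smul_sum]
        refine Finset.sum_congr rfl fun ℓ _ => ?_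
        rw [smul_comm]
        rfl
      cont := continuous_finsetSum _ fun ℓ _ =>
        (ContinuousMap.continuous_precomp (actMap hT ℓ)).fun_const_smul (u ℓ : ℂ) }
  let A : C(G, ℂ) →L[ℂ] Lp ℂ 2 μ := (toL2 μ).comp L
  have hA : ∀ g, A g = toL2 μ (∑ ℓ ∈ F, (u ℓ : ℂ) • g.comp (actMap hT ℓ)) := fun g => rfl
  rw [← hA]
  have hs := (A.hasSum hh).tsum_eq
  rw [← hs]
  refine tsum_of_norm_bounded (hc.hasSum.mul_right _) fun χ => ?_
  rw [map_smul, norm_smul]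
  by_cases hχ : χ = 1
  · simp [hχ, hc1]
  · rw [hA, norm_toL2_sum_charMap μ hT hTerg hχ]

end Orbits

/-! ### Regular functions -/

section Regular

variable {G : Type*} [CommGroup G] [TopologicalSpace G] [CompactSpace G] [MeasurableSpace G]
  {μ : Measure G} {f : G → ℝ}

omit [MeasurableSpace G] in
lemma norm_charMap_le (χ : PontryaginDual G) : ‖charMap χ‖ ≤ 1 :=
  (ContinuousMap.norm_le _ zero_le_one).2 fun _ => (Circle.norm_coe _).le

/-- A regular function as a complex continuous function, the sum of its Fourier series. -/
def fourierSum (μ : Measure G) (f : G → ℝ) : C(G, ℂ) :=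
  ∑' χ : PontryaginDual G, fourierCoefficient μ f χ • charMap χ

lemma IsRegularFunction.hasSum (hf : IsRegularFunction μ f) :
    HasSum (fun χ => fourierCoefficient μ f χ • charMap χ) (fourierSum μ f) := by
  refine (Summable.of_norm_bounded hf.summable fun χ => ?_).hasSum
  rw [norm_smul]
  exact mul_le_of_le_one_right (norm_nonneg _) (norm_charMap_le χ)

lemma IsRegularFunction.fourierSum_apply (hf : IsRegularFunction μ f) (x : G) :
    fourierSum μ f x = (f x : ℂ) := by
  rw [hf.eq_tsum x]
  exact ((ContinuousMap.evalCLM ℂ x).hasSum hf.hasSum).tsum_eq.symm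

lemma IsRegularFunction.continuous (hf : IsRegularFunction μ f) : Continuous f := by
  have : f = fun x => (fourierSum μ f x).re := by
    ext x
    simp [hf.fourierSum_apply]
  rw [this]
  fun_prop

omit [CompactSpace G] in
lemma IsRegularFunction.fourierCoefficient_one (hf : IsRegularFunction μ f) :
    fourierCoefficient μ f 1 = 0 := by
  simp [fourierCoefficient, integral_complex_ofReal, hf.integral_eq_zero]

omit [CompactSpace G] [MeasurableSpace G] in
lemma charMap_inv (χ : PontryaginDual G) (x : G) :
    charMap χ⁻¹ x = (starRingEnd ℂ) (charMap χ x) := by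
  have : (χ⁻¹ : PontryaginDual G) x = (χ x)⁻¹ := rfl
  rw [charMap_apply, charMap_apply, this, Circle.coe_inv_eq_conj]

omit [CompactSpace G] in
lemma fourierCoefficient_inv (χ : PontryaginDual G) :
    fourierCoefficient μ f χ⁻¹ = (starRingEnd ℂ) (fourierCoefficient μ f χ) := by
  rw [fourierCoefficient, fourierCoefficient, ← integral_conj]
  refine integral_congr_ae (Eventually.of_forall fun x => ?_)
  have := charMap_inv χ x
  simp only [charMap_apply] at this
  simp [this]

omit [CompactSpace G] in
-- Truncating over a symmetric set keeps the polynomial real, as the method of moments requires.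
lemma conj_trigPoly {Φ : Finset (PontryaginDual G)} (hΦ : ∀ χ ∈ Φ, χ⁻¹ ∈ Φ) (x : G) :
    (starRingEnd ℂ) (trigPoly Φ (fourierCoefficient μ f) x) =
      trigPoly Φ (fourierCoefficient μ f) x := by
  simp only [trigPoly, ContinuousMap.sum_apply, ContinuousMap.smul_apply, map_sum, smul_eq_mul,
    map_mul]
  refine Finset.sum_nbij' (fun χ => χ⁻¹) (fun χ => χ⁻¹) hΦ hΦ (fun χ _ => inv_inv χ)
    (fun χ _ => inv_inv χ) fun χ _ => ?_
  rw [charMap_inv, fourierCoefficient_inv]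

omit [CompactSpace G] in
lemma ofReal_re_trigPoly {Φ : Finset (PontryaginDual G)} (hΦ : ∀ χ ∈ Φ, χ⁻¹ ∈ Φ) (x : G) :
    ((trigPoly Φ (fourierCoefficient μ f) x).re : ℂ) = trigPoly Φ (fourierCoefficient μ f) x :=
  Complex.conj_eq_iff_re.1 (conj_trigPoly hΦ x)

omit [CompactSpace G] [MeasurableSpace G] in
lemma exists_symm_tsum_lt (c : PontryaginDual G → ℂ) {ε : ℝ}
    (hε : 0 < ε) : ∃ Φ : Finset (PontryaginDual G), (∀ χ ∈ Φ, χ⁻¹ ∈ Φ) ∧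
      ∑' χ, ‖((Φ : Set (PontryaginDual G))ᶜ).indicator c χ‖ < ε := by
  classical
  have h := tendsto_tsum_compl_atTop_zero fun χ => ‖c χ‖
  obtain ⟨s, hs⟩ := eventually_atTop.1 ((tendsto_order.1 h).2 ε hε)
  refine ⟨s ∪ s.image fun χ => χ⁻¹, ?_, ?_⟩
  · intro χ hχ
    rw [Finset.mem_union, Finset.mem_image] at hχ ⊢
    rcases hχ with hχ | ⟨ψ, hψ, rfl⟩
    · exact Or.inr ⟨χ, hχ, rfl⟩
    · exact Or.inl (by simpa using hψ)
  · have h1 := hs (s ∪ s.image fun χ => χ⁻¹) Finset.subset_union_left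
    refine lt_of_eq_of_lt ?_ h1
    have h2 := tsum_subtype ((↑(s ∪ s.image fun χ => χ⁻¹) : Set (PontryaginDual G))ᶜ)
      fun χ => ‖c χ‖
    simp only [norm_indicator_eq_indicator_norm]
    exact h2.symm

omit [MeasurableSpace G] in
lemma hasSum_sub_trigPoly {c : PontryaginDual G → ℂ} {h : C(G, ℂ)}
    (hh : HasSum (fun χ => c χ • charMap χ) h) (Φ : Finset (PontryaginDual G)) :
    HasSum (fun χ => ((Φ : Set (PontryaginDual G))ᶜ).indicator c χ • charMap χ)
      (h - trigPoly Φ c) := by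
  classical
  have h1 : HasSum (fun χ => if χ ∈ Φ then c χ • charMap χ else 0) (trigPoly Φ c) := by
    have : HasSum (fun χ => if χ ∈ Φ then c χ • charMap χ else 0) _ :=
      hasSum_sum_of_ne_finset_zero (s := Φ) fun χ hχ => if_neg hχ
    rwa [Finset.sum_congr rfl fun χ hχ => if_pos hχ] at this
  refine (hh.sub h1).congr_fun fun χ => ?_
  by_cases hχ : χ ∈ Φ <;> simp [hχ]

end Regular


/-! ### The spectral density -/

section Integral

variable {K : Type*} [TopologicalSpace K] [CompactSpace K] [MeasurableSpace K] [BorelSpace K]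

/-- Integration as a continuous linear functional on the continuous functions. -/
def integralFunctional (μ : Measure K) [IsProbabilityMeasure μ] : C(K, ℂ) →L[ℂ] ℂ :=
  LinearMap.mkContinuous
    { toFun := fun g => ∫ x, g x ∂μ
      map_add' := fun g h => integral_add (integrable_continuousMap μ g)
        (integrable_continuousMap μ h)
      map_smul' := fun a g => integral_const_mul a g } 1 fun g => by
    refine (norm_integral_le_of_norm_le_const
      (Eventually.of_forall fun x => g.norm_coe_le_norm x)).trans ?_
    simp

@[simp] lemma integralFunctional_apply (μ : Measure K) [IsProbabilityMeasure μ] (g : C(K, ℂ)) :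
    integralFunctional μ g = ∫ x, g x ∂μ := rfl

end Integral

/-! ### Trigonometric series on the torus -/

section Torus

variable {d : ℕ}

open UnitAddTorus

instance : IsProbabilityMeasure (torusHaar d) := by
  unfold torusHaar; infer_instance

instance : (torusHaar d).IsOpenPosMeasure := by
  unfold torusHaar; infer_instance

lemma mFourierCoeff_eq (g : UnitAddTorus (Fin d) → ℂ) (ℓ : Fin d → ℤ) :
    mFourierCoeff g ℓ = ∫ t, mFourier (-ℓ) t * g t ∂(torusHaar d) := rfl

lemma integral_mFourier (k : Fin d → ℤ) :
    ∫ t, mFourier k t ∂(torusHaar d) = if k = 0 then 1 else 0 := by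
  have h := orthonormal_iff_ite.1 (orthonormal_mFourier (d := Fin d)) 0 k
  rw [ContinuousMap.inner_toLp] at h
  simp only [mFourier_zero, ContinuousMap.one_apply, map_one, mul_one,
    eq_comm (a := (0 : Fin d → ℤ))] at h
  exact h

/-- The Fourier coefficients of a trigonometric series with summable coefficients `γ`. -/
lemma mFourierCoeff_tsum {γ : (Fin d → ℤ) → ℂ} (hγ : Summable fun ℓ => ‖γ ℓ‖) (k : Fin d → ℤ) :
    mFourierCoeff (∑' ℓ, γ ℓ • mFourier ℓ : C(UnitAddTorus (Fin d), ℂ)) k = γ k := by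
  have hs : HasSum (fun ℓ => γ ℓ • mFourier ℓ : _ → C(UnitAddTorus (Fin d), ℂ))
      (∑' ℓ, γ ℓ • mFourier ℓ) :=
    (Summable.of_norm_bounded hγ fun ℓ => by rw [norm_smul, mFourier_norm, mul_one]).hasSum
  have h := (integralFunctional (torusHaar d)).hasSum (hs.mul_left (mFourier (-k)))
  have hterm : ∀ ℓ, integralFunctional (torusHaar d) (mFourier (-k) * γ ℓ • mFourier ℓ) =
      if ℓ = k then γ k else 0 := by
    intro ℓ
    have : (mFourier (-k) * γ ℓ • mFourier ℓ : C(UnitAddTorus (Fin d), ℂ)) =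
        γ ℓ • mFourier (-k + ℓ) := by
      ext t
      simp only [ContinuousMap.mul_apply, ContinuousMap.smul_apply, smul_eq_mul, mFourier_add]
      ring
    rw [this, map_smul, integralFunctional_apply, integral_mFourier, smul_eq_mul]
    by_cases hk : ℓ = k
    · subst hk; simp
    · simp [hk, neg_add_eq_zero, Ne.symm hk]
  simp only [hterm] at h
  rw [mFourierCoeff_eq]
  exact h.unique (hasSum_ite_eq k (γ k))

/-- The integral of `φ` against the square of a trigonometric polynomial. -/
lemma integral_mul_normSq_trig (φ : C(UnitAddTorus (Fin d), ℂ)) (F : Finset (Fin d → ℤ))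
    (p : (Fin d → ℤ) → ℂ) :
    integralFunctional (torusHaar d)
      (φ * ((∑ ℓ ∈ F, p ℓ • mFourier ℓ) * star (∑ ℓ ∈ F, p ℓ • mFourier ℓ))) =
      ∑ ℓ ∈ F, ∑ k ∈ F, p ℓ * (starRingEnd ℂ) (p k) * mFourierCoeff φ (k - ℓ) := by
  rw [star_sum, Finset.sum_mul_sum, Finset.mul_sum, map_sum]
  refine Finset.sum_congr rfl fun ℓ _ => ?_
  rw [Finset.mul_sum, map_sum]
  refine Finset.sum_congr rfl fun k _ => ?_
  rw [mFourierCoeff_eq, integralFunctional_apply, ← integral_const_mul]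
  refine integral_congr_ae (Eventually.of_forall fun t => ?_)
  simp only [ContinuousMap.mul_apply, ContinuousMap.smul_apply, ContinuousMap.star_apply,
    smul_eq_mul, star_mul', neg_sub, sub_eq_add_neg ℓ k, mFourier_add, mFourier_neg,
    RCLike.star_def]
  ring

end Torus

/-! ### Autocorrelations and the spectral density of a regular function -/

section Spectral

open UnitAddTorus

variable {d : ℕ} {G : Type*} [CommGroup G] [TopologicalSpace G] [IsTopologicalGroup G]
  [CompactSpace G] [MeasurableSpace G] [BorelSpace G]
  {μ : Measure G} [μ.IsHaarMeasure] [IsProbabilityMeasure μ]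
  {T : Multiplicative (Fin d → ℤ) →* MulAut G} {f : G → ℝ}

/-- The autocorrelation `⟨T^ℓ f, f⟩`. -/
def autocorrelation (T : Multiplicative (Fin d → ℤ) →* MulAut G) (μ : Measure G) (f : G → ℝ)
    (ℓ : Fin d → ℤ) : ℝ := ∫ x, f (act T ℓ x) * f x ∂μ

omit [IsTopologicalGroup G] [CompactSpace G] [μ.IsHaarMeasure] [IsProbabilityMeasure μ] in
lemma integral_mul_act (hT : ∀ ℓ, Continuous (act T ℓ)) (hTerg : IsTotallyErgodic T μ)
    (hf : Continuous f) (ℓ k : Fin d → ℤ) :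
    ∫ x, f (act T ℓ x) * f (act T k x) ∂μ = autocorrelation T μ f (k - ℓ) := by
  have h := integral_comp_act (μ := μ) hT hTerg ℓ (g := fun x => f (act T (k - ℓ) x) * f x)
    ((hf.comp (hT _)).mul hf)
  rw [autocorrelation, ← h]
  refine integral_congr_ae (Eventually.of_forall fun x => ?_)
  simp only [← act_add, sub_add_cancel]
  ring

omit [IsTopologicalGroup G] [CompactSpace G] [μ.IsHaarMeasure] [IsProbabilityMeasure μ] in
lemma autocorrelation_neg (hT : ∀ ℓ, Continuous (act T ℓ)) (hTerg : IsTotallyErgodic T μ)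
    (hf : Continuous f) (ℓ : Fin d → ℤ) :
    autocorrelation T μ f (-ℓ) = autocorrelation T μ f ℓ := by
  rw [← zero_sub ℓ, ← integral_mul_act hT hTerg hf ℓ 0, autocorrelation]
  simp only [act_zero]

omit [μ.IsHaarMeasure] in
-- Parseval: only the factor `f ∘ T^ℓ` is expanded, and integrating `χ ∘ T^ℓ` against `f` gives the
-- coefficient at the inverse character.
lemma hasSum_autocorrelation (hT : ∀ ℓ, Continuous (act T ℓ)) (hf : IsRegularFunction μ f)
    (ℓ : Fin d → ℤ) :
    HasSum (fun χ => fourierCoefficient μ f χ * fourierCoefficient μ f (dualAct hT ℓ χ)⁻¹)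
      (autocorrelation T μ f ℓ : ℂ) := by
  let L : C(G, ℂ) →+ C(G, ℂ) :=
    { toFun := fun g => g.comp (actMap hT ℓ), map_zero' := rfl, map_add' := fun _ _ => rfl }
  have h := (integralFunctional μ).hasSum
    ((hf.hasSum.map L (ContinuousMap.continuous_precomp _)).mul_right (fourierSum μ f))
  have hlim : integralFunctional μ (L (fourierSum μ f) * fourierSum μ f) =
      (autocorrelation T μ f ℓ : ℂ) := by
    rw [integralFunctional_apply, autocorrelation, ← integral_complex_ofReal]
    refine integral_congr_ae (Eventually.of_forall fun x => ?_)
    change fourierSum μ f (act T ℓ x) * fourierSum μ f x = _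
    simp only [hf.fourierSum_apply]
    push_cast
    rfl
  rw [hlim] at h
  refine h.congr_fun fun χ => ?_
  have hc : fourierCoefficient μ f (dualAct hT ℓ χ)⁻¹ =
      ∫ x, (f x : ℂ) * (starRingEnd ℂ) ((dualAct hT ℓ χ)⁻¹ x : ℂ) ∂μ := rfl
  rw [hc, Function.comp_apply, integralFunctional_apply, ← integral_const_mul]
  refine integral_congr_ae (Eventually.of_forall fun x => ?_)
  have hx : ((dualAct hT ℓ χ)⁻¹ x : ℂ) = (starRingEnd ℂ) (dualAct hT ℓ χ x : ℂ) :=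
    charMap_inv (dualAct hT ℓ χ) x
  change _ = fourierCoefficient μ f χ * (χ (act T ℓ x) : ℂ) * fourierSum μ f x
  simp only [hx, hf.fourierSum_apply, Complex.conj_conj, dualAct_apply]
  ring

/-- For fixed `χ ≠ 1` the characters `(χ ∘ T^ℓ)⁻¹` are distinct, so summing over `ℓ` first costs at
most `∑ ‖c χ‖`; summing over `χ` then gives the square. -/
lemma summable_autocorrelation (hT : ∀ ℓ, Continuous (act T ℓ)) (hTerg : IsTotallyErgodic T μ)
    (hf : IsRegularFunction μ f) : Summable fun ℓ => ‖(autocorrelation T μ f ℓ : ℂ)‖ := by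
  set c := fourierCoefficient μ f with hc
  let H : PontryaginDual G × (Fin d → ℤ) → ℝ := fun q => ‖c q.1‖ * ‖c (dualAct hT q.2 q.1)⁻¹‖
  have hH0 : 0 ≤ H := fun q => by positivity
  have hinj : ∀ χ : PontryaginDual G, χ ≠ 1 →
      Function.Injective fun ℓ => (dualAct hT ℓ χ)⁻¹ := fun χ hχ =>
    inv_injective.comp (dualAct_injective μ hT hTerg hχ)
  have hrow : ∀ χ, Summable fun ℓ => H (χ, ℓ) := by
    intro χ
    by_cases hχ : χ = 1
    · simp [H, hχ, hc, hf.fourierCoefficient_one]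
    · exact (hf.summable.comp_injective (hinj χ hχ)).mul_left ‖c χ‖
  have hsum : Summable H := by
    refine (summable_prod_of_nonneg hH0).2 ⟨hrow, ?_⟩
    refine Summable.of_nonneg_of_le (fun χ => tsum_nonneg fun ℓ => hH0 _) (fun χ => ?_)
      (hf.summable.mul_right (∑' χ, ‖c χ‖))
    by_cases hχ : χ = 1
    · simp [H, hχ, hc, hf.fourierCoefficient_one]
    · simp only [H]
      rw [tsum_mul_left]
      refine mul_le_mul_of_nonneg_left ?_ (norm_nonneg _)
      exact (hf.summable.comp_injective (hinj χ hχ)).tsum_le_tsum_of_inj _ (hinj χ hχ)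
        (fun _ _ => norm_nonneg _) (fun _ => le_rfl) hf.summable
  have hsymm : Summable fun q : (Fin d → ℤ) × PontryaginDual G => H q.swap := hsum.prod_symm
  refine Summable.of_nonneg_of_le (fun ℓ => norm_nonneg _) (fun ℓ => ?_) hsymm.prod
  rw [← (hasSum_autocorrelation hT hf ℓ).tsum_eq]
  exact tsum_of_norm_bounded (hsymm.prod_factor ℓ).hasSum fun χ => by
    simp [H, hc]

omit [IsTopologicalGroup G] [μ.IsHaarMeasure] in
lemma integral_normSq_sum (hT : ∀ ℓ, Continuous (act T ℓ)) (hTerg : IsTotallyErgodic T μ)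
    (hf : IsRegularFunction μ f) (F : Finset (Fin d → ℤ)) (p : (Fin d → ℤ) → ℂ) :
    integralFunctional μ ((∑ ℓ ∈ F, p ℓ • (fourierSum μ f).comp (actMap hT ℓ)) *
        star (∑ ℓ ∈ F, p ℓ • (fourierSum μ f).comp (actMap hT ℓ))) =
      ∑ ℓ ∈ F, ∑ k ∈ F, p ℓ * (starRingEnd ℂ) (p k) * (autocorrelation T μ f (k - ℓ) : ℂ) := by
  rw [star_sum, Finset.sum_mul_sum, map_sum]
  refine Finset.sum_congr rfl fun ℓ _ => ?_
  rw [map_sum]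
  refine Finset.sum_congr rfl fun k _ => ?_
  rw [← integral_mul_act hT hTerg hf.continuous, integralFunctional_apply,
    ← integral_complex_ofReal, ← integral_const_mul]
  refine integral_congr_ae (Eventually.of_forall fun x => ?_)
  simp only [ContinuousMap.mul_apply, ContinuousMap.smul_apply, ContinuousMap.star_apply,
    smul_eq_mul, star_mul', RCLike.star_def, ContinuousMap.comp_apply, actMap_apply,
    hf.fourierSum_apply, Complex.conj_ofReal]
  push_cast
  ring

omit [IsTopologicalGroup G] [μ.IsHaarMeasure] in
/-- The quadratic forms of `f` and of a density with the same coefficients agree. -/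
lemma integral_normSq_eq (hT : ∀ ℓ, Continuous (act T ℓ)) (hTerg : IsTotallyErgodic T μ)
    (hf : IsRegularFunction μ f) {φ : C(UnitAddTorus (Fin d), ℂ)}
    (hφ : ∀ ℓ, mFourierCoeff φ ℓ = (autocorrelation T μ f ℓ : ℂ)) (F : Finset (Fin d → ℤ))
    (p : (Fin d → ℤ) → ℂ) :
    integralFunctional (torusHaar d)
      (φ * ((∑ ℓ ∈ F, p ℓ • mFourier ℓ) * star (∑ ℓ ∈ F, p ℓ • mFourier ℓ))) =
    integralFunctional μ ((∑ ℓ ∈ F, p ℓ • (fourierSum μ f).comp (actMap hT ℓ)) *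
        star (∑ ℓ ∈ F, p ℓ • (fourierSum μ f).comp (actMap hT ℓ))) := by
  rw [integral_mul_normSq_trig, integral_normSq_sum hT hTerg hf]
  simp only [hφ]

omit [IsTopologicalGroup G] [μ.IsHaarMeasure] in
-- For a trigonometric polynomial `g` the integral is a squared `L²` norm on `G`; density of these
-- polynomials does the rest.
lemma integral_mul_normSq_nonneg (hT : ∀ ℓ, Continuous (act T ℓ)) (hTerg : IsTotallyErgodic T μ)
    (hf : IsRegularFunction μ f) {φ : C(UnitAddTorus (Fin d), ℂ)}
    (hφ : ∀ ℓ, mFourierCoeff φ ℓ = (autocorrelation T μ f ℓ : ℂ))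
    (g : C(UnitAddTorus (Fin d), ℂ)) :
    0 ≤ (integralFunctional (torusHaar d) (φ * (g * star g))).re := by
  have hclosed : IsClosed {g : C(UnitAddTorus (Fin d), ℂ) |
      0 ≤ (integralFunctional (torusHaar d) (φ * (g * star g))).re} := by
    refine isClosed_le continuous_const ?_
    refine Complex.continuous_re.comp ((integralFunctional (torusHaar d)).continuous.comp ?_)
    fun_prop
  have hg : g ∈ (Submodule.span ℂ (Set.range (mFourier (d := Fin d)))).topologicalClosure := by
    rw [span_mFourier_closure_eq_top]
    trivial
  refine closure_minimal (fun h hh => ?_) hclosed hg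
  obtain ⟨p, rfl⟩ := Finsupp.mem_span_range_iff_exists_finsupp.1 hh
  simp only [Finsupp.sum, Set.mem_ofPred_eq]
  rw [integral_normSq_eq hT hTerg hf hφ, integralFunctional_apply]
  set S := ∑ ℓ ∈ p.support, p ℓ • (fourierSum μ f).comp (actMap hT ℓ)
  have : ∀ x, (S * star S) x = ((‖S x‖ ^ 2 : ℝ) : ℂ) := fun x => by
    simp only [ContinuousMap.mul_apply, ContinuousMap.star_apply, RCLike.star_def]
    rw [Complex.mul_conj, Complex.normSq_eq_norm_sq]
  simp only [this]
  rw [integral_complex_ofReal, Complex.ofReal_re]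
  exact integral_nonneg fun x => by positivity

omit [IsTopologicalGroup G] [μ.IsHaarMeasure] in
lemma nonneg_of_coeff (hT : ∀ ℓ, Continuous (act T ℓ)) (hTerg : IsTotallyErgodic T μ)
    (hf : IsRegularFunction μ f) (φ : C(UnitAddTorus (Fin d), ℝ))
    (hφ : ∀ ℓ, mFourierCoeff (fun t => (φ t : ℂ)) ℓ = (autocorrelation T μ f ℓ : ℂ))
    (t : UnitAddTorus (Fin d)) : 0 ≤ φ t := by
  let φC : C(UnitAddTorus (Fin d), ℂ) := ⟨fun t => (φ t : ℂ), by fun_prop⟩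
  -- Testing with the negative part `ψ` of `φ` gives `φ ψ² = -ψ³`, so `∫ ψ³ ≤ 0` and `ψ` vanishes.
  let ψ : UnitAddTorus (Fin d) → ℝ := fun t => max (-φ t) 0
  have hψ : Continuous ψ := by fun_prop
  let g : C(UnitAddTorus (Fin d), ℂ) := ⟨fun t => (ψ t : ℂ), by fun_prop⟩
  have h := integral_mul_normSq_nonneg hT hTerg hf (φ := φC) hφ g
  have heq : ∀ t, (φC * (g * star g)) t = ((-(ψ t ^ 3) : ℝ) : ℂ) := by
    intro t
    have hreal : φ t * (ψ t * ψ t) = -(ψ t ^ 3) := by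
      rcases le_total (φ t) 0 with hle | hle
      · have : ψ t = -φ t := max_eq_left (by linarith)
        rw [this]; ring
      · have : ψ t = 0 := max_eq_right (by linarith)
        rw [this]; ring
    rw [← hreal]
    simp [φC, g]
  rw [integralFunctional_apply] at h
  simp only [heq] at h
  rw [integral_complex_ofReal, Complex.ofReal_re, integral_neg] at h
  have hψ0 : ∀ t, 0 ≤ ψ t := fun t => le_max_right _ _
  have hint : ∫ t, ψ t ^ 3 ∂(torusHaar d) = 0 :=
    le_antisymm (by linarith) (integral_nonneg fun t => pow_nonneg (hψ0 t) 3)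
  rw [integral_eq_zero_iff_of_nonneg (fun t => pow_nonneg (hψ0 t) 3)
    ((hψ.pow 3).integrable_of_hasCompactSupport (HasCompactSupport.of_compactSpace _))] at hint
  have hz := congrFun ((hψ.pow 3).ae_eq_iff_eq (torusHaar d) continuous_const |>.1 hint) t
  have : ψ t = 0 := pow_eq_zero_iff three_ne_zero |>.1 hz
  have := le_max_left (-φ t) 0
  have h' : -φ t ≤ ψ t := this
  linarith

/-- A regular function has a continuous spectral density. -/
theorem exists_isSpectralDensity (hT : ∀ ℓ, Continuous (act T ℓ)) (hTerg : IsTotallyErgodic T μ)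
    (hf : IsRegularFunction μ f) :
    ∃ φ : C(UnitAddTorus (Fin d), ℝ), IsSpectralDensity T μ f φ := by
  have hs := summable_autocorrelation hT hTerg hf
  set Φ : C(UnitAddTorus (Fin d), ℂ) := ∑' ℓ, (autocorrelation T μ f ℓ : ℂ) • mFourier ℓ with hΦ
  have hsum : HasSum (fun ℓ => (autocorrelation T μ f ℓ : ℂ) • mFourier ℓ) Φ :=
    (Summable.of_norm_bounded hs fun ℓ => by rw [norm_smul, mFourier_norm, mul_one]).hasSum
  have hpt : ∀ t, HasSum (fun ℓ => (autocorrelation T μ f ℓ : ℂ) * mFourier ℓ t) (Φ t) := fun t =>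
    (ContinuousMap.evalCLM ℂ t).hasSum hsum
  have hreal : ∀ t, (((Φ t).re : ℝ) : ℂ) = Φ t := by
    intro t
    refine Complex.conj_eq_iff_re.1 ?_
    have h1 := (Complex.hasSum_conj'.2 (hpt t))
    have h2 := (Equiv.neg (Fin d → ℤ)).hasSum_iff.2 (hpt t)
    refine h1.unique (h2.congr_fun fun ℓ => ?_)
    simp only [Function.comp_apply, Equiv.neg_apply, mFourier_neg, map_mul, Complex.conj_ofReal,
      autocorrelation_neg hT hTerg hf.continuous]
  let φ : C(UnitAddTorus (Fin d), ℝ) := ⟨fun t => (Φ t).re, by fun_prop⟩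
  have hcoeff : ∀ ℓ, mFourierCoeff (fun t => (φ t : ℂ)) ℓ = (autocorrelation T μ f ℓ : ℂ) := by
    intro ℓ
    have : (fun t => (φ t : ℂ)) = Φ := funext hreal
    rw [this]
    exact mFourierCoeff_tsum hs ℓ
  exact ⟨φ, nonneg_of_coeff hT hTerg hf φ hcoeff,
    φ.continuous.integrable_of_hasCompactSupport (HasCompactSupport.of_compactSpace _), hcoeff⟩

omit [IsTopologicalGroup G] [MeasurableSpace G] [BorelSpace G] in
/-- The infinite weighted sum as a continuous function. -/
lemma hasSum_smul_comp (hT : ∀ ℓ, Continuous (act T ℓ)) (g : C(G, ℂ)) {u : (Fin d → ℤ) → ℝ}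
    (h0 : ∀ ℓ, 0 ≤ u ℓ) (hu : Summable u) :
    HasSum (fun ℓ => (u ℓ : ℂ) • g.comp (actMap hT ℓ))
      (∑' ℓ, (u ℓ : ℂ) • g.comp (actMap hT ℓ)) := by
  refine (Summable.of_norm_bounded (hu.mul_right ‖g‖) fun ℓ => ?_).hasSum
  rw [norm_smul, Complex.norm_real, Real.norm_of_nonneg (h0 ℓ)]
  refine mul_le_mul_of_nonneg_left ?_ (h0 ℓ)
  exact (ContinuousMap.norm_le _ (norm_nonneg _)).2 fun x => g.norm_coe_le_norm _

omit [μ.IsHaarMeasure] [IsProbabilityMeasure μ] [IsTopologicalGroup G] [BorelSpace G] in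
lemma tsum_smul_comp_apply (hT : ∀ ℓ, Continuous (act T ℓ)) (hf : IsRegularFunction μ f)
    {u : (Fin d → ℤ) → ℝ} (h0 : ∀ ℓ, 0 ≤ u ℓ) (hu : Summable u) (x : G) :
    (∑' ℓ, (u ℓ : ℂ) • (fourierSum μ f).comp (actMap hT ℓ)) x =
      ((∑' ℓ, u ℓ * f (act T ℓ x) : ℝ) : ℂ) := by
  have h := (ContinuousMap.evalCLM ℂ x).hasSum (hasSum_smul_comp hT (fourierSum μ f) h0 hu)
  rw [Complex.ofReal_tsum]
  refine h.tsum_eq.symm.trans (tsum_congr fun ℓ => ?_)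
  push_cast
  rw [← hf.fourierSum_apply]
  rfl

omit [μ.IsHaarMeasure] in
/-- The second moment of a weighted sum is the integral of the spectral density against the
squared transform of the weights. -/
theorem integral_sq_tsum (hT : ∀ ℓ, Continuous (act T ℓ)) (hTerg : IsTotallyErgodic T μ)
    (hf : IsRegularFunction μ f) {φ : C(UnitAddTorus (Fin d), ℝ)}
    (hφ : IsSpectralDensity T μ f φ) {u : (Fin d → ℤ) → ℝ} (h0 : ∀ ℓ, 0 ≤ u ℓ)
    (hu : Summable u) :
    ∫ x, (∑' ℓ, u ℓ * f (act T ℓ x)) ^ 2 ∂μ =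
      ∫ t, ‖∑' ℓ, (u ℓ : ℂ) * mFourier ℓ t‖ ^ 2 * φ t ∂(torusHaar d) := by
  let φC : C(UnitAddTorus (Fin d), ℂ) := ⟨fun t => (φ t : ℂ), by fun_prop⟩
  have hS := hasSum_smul_comp hT (fourierSum μ f) h0 hu
  have hE : HasSum (fun ℓ => (u ℓ : ℂ) • mFourier ℓ)
      (∑' ℓ, (u ℓ : ℂ) • mFourier ℓ : C(UnitAddTorus (Fin d), ℂ)) :=
    (Summable.of_norm_bounded hu fun ℓ => by
      rw [norm_smul, mFourier_norm, mul_one, Complex.norm_real, Real.norm_of_nonneg (h0 ℓ)]).hasSum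
  set S := ∑' ℓ, (u ℓ : ℂ) • (fourierSum μ f).comp (actMap hT ℓ) with hSdef
  set E : C(UnitAddTorus (Fin d), ℂ) := ∑' ℓ, (u ℓ : ℂ) • mFourier ℓ with hEdef
  have hcS : Continuous fun g : C(G, ℂ) => integralFunctional μ (g * star g) :=
    (integralFunctional μ).continuous.comp (by fun_prop)
  have hcE : Continuous fun g : C(UnitAddTorus (Fin d), ℂ) =>
      integralFunctional (torusHaar d) (φC * (g * star g)) :=
    (integralFunctional (torusHaar d)).continuous.comp (by fun_prop)
  have key : integralFunctional μ (S * star S) =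
      integralFunctional (torusHaar d) (φC * (E * star E)) := by
    -- Both quadratic forms are continuous for uniform convergence and agree on finite partial sums.
    refine tendsto_nhds_unique ((hcS.tendsto S).comp hS) ?_
    refine ((hcE.tendsto E).comp hE).congr fun F => ?_
    exact integral_normSq_eq hT hTerg hf (φ := φC) hφ.coeff F fun ℓ => (u ℓ : ℂ)
  apply Complex.ofReal_injective
  rw [← integral_complex_ofReal, ← integral_complex_ofReal]
  refine Eq.trans ?_ (key.trans ?_)
  · refine integral_congr_ae (Eventually.of_forall fun x => ?_)
    simp only [ContinuousMap.mul_apply, ContinuousMap.star_apply, RCLike.star_def, hSdef,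
      tsum_smul_comp_apply hT hf h0 hu, Complex.conj_ofReal]
    push_cast
    ring
  · refine integral_congr_ae (Eventually.of_forall fun t => ?_)
    have hEt : ∑' ℓ, (u ℓ : ℂ) * mFourier ℓ t = E t :=
      ((ContinuousMap.evalCLM ℂ t).hasSum hE).tsum_eq
    simp only [ContinuousMap.mul_apply, ContinuousMap.star_apply, RCLike.star_def, hEt]
    rw [Complex.mul_conj, Complex.normSq_eq_norm_sq, mul_comm]
    push_cast
    rfl

end Spectral


/-! ### The central limit theorem -/

section L2Norm

variable {G : Type*} [TopologicalSpace G] [CompactSpace G] [MeasurableSpace G]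
  [BorelSpace G] (μ : Measure G) [IsProbabilityMeasure μ]

lemma norm_toL2_sq (g : C(G, ℂ)) : ‖toL2 μ g‖ ^ 2 = ∫ x, ‖g x‖ ^ 2 ∂μ := by
  have h := ContinuousMap.inner_toLp (𝕜 := ℂ) μ g g
  rw [inner_self_eq_norm_sq_to_K] at h
  apply Complex.ofReal_injective
  rw [← integral_complex_ofReal]
  push_cast
  refine Eq.trans h (integral_congr_ae (Eventually.of_forall fun x => ?_))
  simp only
  rw [Complex.mul_conj, Complex.normSq_eq_norm_sq]
  push_cast
  rfl

/-- The variance of `‖g‖` is nonnegative. -/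
lemma integral_norm_le_norm_toL2 (g : C(G, ℂ)) : ∫ x, ‖g x‖ ∂μ ≤ ‖toL2 μ g‖ := by
  refine le_of_sq_le_sq ?_ (norm_nonneg _)
  rw [norm_toL2_sq]
  have hi : ∀ {h : G → ℝ}, Continuous h → Integrable h μ := fun hh =>
    hh.integrable_of_hasCompactSupport (HasCompactSupport.of_compactSpace _)
  set m := ∫ x, ‖g x‖ ∂μ with hm
  have h0 : 0 ≤ ∫ x, (‖g x‖ - m) ^ 2 ∂μ := integral_nonneg fun x => sq_nonneg _
  have h1 : ∫ x, (‖g x‖ - m) ^ 2 ∂μ = ∫ x, ‖g x‖ ^ 2 ∂μ - m ^ 2 := by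
    have : ∀ x, (‖g x‖ - m) ^ 2 = ‖g x‖ ^ 2 - (2 * m * ‖g x‖ - m ^ 2) := fun x => by ring
    simp only [this]
    rw [integral_sub (hi (by fun_prop)) (hi (by fun_prop)),
      integral_sub (hi (by fun_prop)) (hi (by fun_prop)), integral_const_mul, ← hm]
    simp
    ring
  linarith

lemma norm_toL2_le (g : C(G, ℂ)) : ‖toL2 μ g‖ ≤ ‖g‖ := by
  refine le_of_sq_le_sq ?_ (norm_nonneg _)
  rw [norm_toL2_sq]
  have h := norm_integral_le_of_norm_le_const (μ := μ) (f := fun x => ‖g x‖ ^ 2) (C := ‖g‖ ^ 2)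
    (Eventually.of_forall fun x => by
      rw [norm_pow, norm_norm]
      gcongr
      exact g.norm_coe_le_norm x)
  simpa using (le_abs_self _).trans h

lemma norm_integral_exp_sub_le {X Y : G → ℝ} (hX : Continuous X) (hY : Continuous Y) (t : ℝ) :
    ‖(∫ x, Complex.exp (t * X x * Complex.I) ∂μ) - ∫ x, Complex.exp (t * Y x * Complex.I) ∂μ‖ ≤
      |t| * ∫ x, |X x - Y x| ∂μ := by
  have hi : ∀ {h : G → ℂ}, Continuous h → Integrable h μ := fun hh =>
    hh.integrable_of_hasCompactSupport (HasCompactSupport.of_compactSpace _)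
  rw [← integral_sub (hi (by fun_prop)) (hi (by fun_prop)), ← integral_const_mul]
  refine norm_integral_le_of_norm_le ((by fun_prop : Continuous fun x => |t| * |X x - Y x|)
    |>.integrable_of_hasCompactSupport (HasCompactSupport.of_compactSpace _))
    (Eventually.of_forall fun x => ?_)
  have h1 : Complex.exp (t * X x * Complex.I) - Complex.exp (t * Y x * Complex.I) =
      Complex.exp ((t * Y x : ℝ) * Complex.I) *
        (Complex.exp ((t * (X x - Y x) : ℝ) * Complex.I) - 1) := by
    rw [mul_sub, ← Complex.exp_add, mul_one]
    push_cast
    ring_nf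
  have h2 := norm_exp_sub_sum_le (z := (t * (X x - Y x) : ℝ) * Complex.I) (by simp) 1
  rw [h1, norm_mul, Complex.norm_exp_ofReal_mul_I, one_mul]
  rw [norm_mul, Complex.norm_I, mul_one, Complex.norm_real, Real.norm_eq_abs, abs_mul] at h2
  simpa using h2

end L2Norm

/-! ### Characteristic functions of the weighted sums -/

section CentralLimit

variable {d : ℕ} {G : Type*} [CommGroup G] [TopologicalSpace G] [IsTopologicalGroup G]
  [CompactSpace G] [MeasurableSpace G] [BorelSpace G]
  {μ : Measure G} [μ.IsHaarMeasure] [IsProbabilityMeasure μ]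
  {T : Multiplicative (Fin d → ℤ) →* MulAut G} {f : G → ℝ}

/-- The weighted sum `∑_{ℓ ∈ F} u(ℓ) g ∘ T^ℓ`. -/
def weightedSum (hT : ∀ ℓ, Continuous (act T ℓ)) (u : (Fin d → ℤ) → ℝ) (F : Finset (Fin d → ℤ))
    (g : C(G, ℂ)) : C(G, ℂ) :=
  ∑ ℓ ∈ F, (u ℓ : ℂ) • g.comp (actMap hT ℓ)

omit [IsTopologicalGroup G] [MeasurableSpace G] [BorelSpace G] in
lemma weightedSum_apply (hT : ∀ ℓ, Continuous (act T ℓ)) (u : (Fin d → ℤ) → ℝ)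
    (F : Finset (Fin d → ℤ)) (g : C(G, ℂ)) (x : G) :
    weightedSum hT u F g x = ∑ ℓ ∈ F, (u ℓ : ℂ) * g (act T ℓ x) := by
  simp [weightedSum]

lemma integral_weightedSum_trigPoly (hT : ∀ ℓ, Continuous (act T ℓ)) (u : (Fin d → ℤ) → ℝ)
    (F : Finset (Fin d → ℤ)) (Φ : Finset (PontryaginDual G)) {c : PontryaginDual G → ℂ}
    (hc : c 1 = 0) : ∫ x, weightedSum hT u F (trigPoly Φ c) x ∂μ = 0 := by
  have hexp : weightedSum hT u F (trigPoly Φ c) =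
      ∑ ℓ ∈ F, (u ℓ : ℂ) • ∑ χ ∈ Φ, c χ • charMap (dualAct hT ℓ χ) := by
    ext x
    simp [weightedSum_apply, trigPoly]
  rw [← integralFunctional_apply, hexp, map_sum]
  refine Finset.sum_eq_zero fun ℓ _ => ?_
  rw [map_smul, map_sum, Finset.sum_eq_zero, smul_zero]
  intro χ _
  rw [map_smul, integralFunctional_apply]
  by_cases hχ : χ = 1
  · rw [hχ, hc, zero_smul]
  · rw [integral_charMap μ (dualAct_ne_one hT ℓ hχ), smul_zero]

/-- The central limit theorem for normalized weights along trigonometric polynomials. -/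
lemma tendsto_charFun_trigPoly (hT : ∀ ℓ, Continuous (act T ℓ)) {u : ℕ → (Fin d → ℤ) → ℝ}
    (h0 : ∀ n ℓ, 0 ≤ u n ℓ) (hu : ∀ n, Summable (u n))
    (hmix : ∀ r : ℕ, 3 ≤ r → ∀ Φ : Finset (PontryaginDual G),
      Tendsto (fun n => ∑' a : nonMixing T μ Φ r, ∏ j, u n (a.1 j)) atTop (𝓝 0))
    (F : ℕ → Finset (Fin d → ℤ)) (Φ : Finset (PontryaginDual G)) {c : PontryaginDual G → ℂ}
    (hc : c 1 = 0) {Z : ℕ → G → ℝ}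
    (hZ : ∀ n x, (Z n x : ℂ) = weightedSum hT (u n) (F n) (trigPoly Φ c) x)
    {V : ℝ} (hV : ∀ n, ∫ x, Z n x ^ 2 ∂μ ≤ V) (t : ℝ) :
    Tendsto (fun n => (∫ x, Complex.exp (t * Z n x * Complex.I) ∂μ) -
      Complex.exp (-(t ^ 2 * (∫ x, Z n x ^ 2 ∂μ : ℝ) / 2))) atTop (𝓝 0) := by
  have hcont : ∀ n, Continuous (Z n) := by
    intro n
    have : Z n = fun x => (weightedSum hT (u n) (F n) (trigPoly Φ c) x).re := by
      ext x
      rw [← hZ, Complex.ofReal_re]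
    rw [this]
    fun_prop
  refine tendsto_charFun_sub_exp μ (fun n r => ((hcont n).pow r).integrable_of_hasCompactSupport
    (HasCompactSupport.of_compactSpace _)) (fun n => ?_) hV (fun r hr => ?_) t
  · apply Complex.ofReal_injective
    rw [← integral_complex_ofReal, Complex.ofReal_zero,
      ← integral_weightedSum_trigPoly (μ := μ) hT (u n) (F n) Φ hc]
    simp only [hZ]
  · have hlim := (hmix r hr Φ).const_mul (cumulantBound r * (∑ χ ∈ Φ, ‖c χ‖) ^ r)
    rw [mul_zero] at hlim
    refine squeeze_zero_norm (fun n => ?_) hlim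
    refine (le_of_eq ?_).trans (norm_momentCumulant_sum_le μ hT Φ c (h0 n) (hu n) (F n) r)
    congr 2
    ext k
    rw [← integral_complex_ofReal]
    refine integral_congr_ae (Eventually.of_forall fun x => ?_)
    simp only
    rw [Complex.ofReal_pow, hZ, weightedSum_apply]

lemma norm_exp_neg_sub_le {a b : ℝ} (ha : 0 ≤ a) (hb : 0 ≤ b) :
    ‖Complex.exp (-(a : ℂ)) - Complex.exp (-(b : ℂ))‖ ≤ |a - b| := by
  wlog hab : b ≤ a generalizing a b
  · rw [norm_sub_rev, abs_sub_comm]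
    exact this hb ha (le_of_not_ge hab)
  have h1 : Complex.exp (-(a : ℂ)) - Complex.exp (-(b : ℂ)) =
      Complex.exp (-(b : ℂ)) * (Complex.exp (-((a - b : ℝ) : ℂ)) - 1) := by
    rw [mul_sub, ← Complex.exp_add, mul_one]
    push_cast
    ring_nf
  have h2 := norm_exp_sub_sum_le (z := -((a - b : ℝ) : ℂ)) (by
    rw [Complex.neg_re, Complex.ofReal_re]; linarith) 1
  have h3 : ‖Complex.exp (-(b : ℂ))‖ ≤ 1 := by
    rw [Complex.norm_exp]
    simpa using hb
  rw [h1, norm_mul]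
  refine (mul_le_of_le_one_left (norm_nonneg _) h3).trans ?_
  rw [norm_neg, Complex.norm_real] at h2
  simpa using h2

/-- The central limit theorem for normalized weights, in terms of characteristic functions. -/
theorem tendsto_charFun_tsum (hT : ∀ ℓ, Continuous (act T ℓ)) (hTerg : IsTotallyErgodic T μ)
    (hf : IsRegularFunction μ f) {u : ℕ → (Fin d → ℤ) → ℝ}
    (h0 : ∀ n ℓ, 0 ≤ u n ℓ) (hu : ∀ n, Summable (u n))
    (hsq : ∀ n (F : Finset (Fin d → ℤ)), ∑ ℓ ∈ F, u n ℓ ^ 2 ≤ 1)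
    (hmix : ∀ r : ℕ, 3 ≤ r → ∀ Φ : Finset (PontryaginDual G),
      Tendsto (fun n => ∑' a : nonMixing T μ Φ r, ∏ j, u n (a.1 j)) atTop (𝓝 0))
    {X : ℕ → G → ℝ} (hX : ∀ n x, X n x = ∑' ℓ, u n ℓ * f (act T ℓ x)) {v : ℝ}
    (hv : Tendsto (fun n => ∫ x, X n x ^ 2 ∂μ) atTop (𝓝 v)) (t : ℝ) :
    Tendsto (fun n => ∫ x, Complex.exp (t * X n x * Complex.I) ∂μ) atTop
      (𝓝 (Complex.exp (-(t ^ 2 * v / 2)))) := by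
  set c := fourierCoefficient μ f with hcdef
  set XC : ℕ → C(G, ℂ) := fun n => ∑' ℓ, (u n ℓ : ℂ) • (fourierSum μ f).comp (actMap hT ℓ)
  have hXC : ∀ n x, XC n x = (X n x : ℂ) := fun n x => by
    rw [hX]
    exact tsum_smul_comp_apply hT hf (h0 n) (hu n) x
  have hcontX : ∀ n, Continuous (X n) := by
    intro n
    have : X n = fun x => (XC n x).re := by
      ext x
      rw [hXC, Complex.ofReal_re]
    rw [this]
    fun_prop
  -- The cumulant bound concerns finite sums, so each series is cut at a finite set with uniform
  -- error below `1 / (n + 1)`.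
  have hF : ∀ n : ℕ, ∃ F : Finset (Fin d → ℤ),
      ‖XC n - weightedSum hT (u n) F (fourierSum μ f)‖ < 1 / ((n : ℝ) + 1) := by
    intro n
    have h := (hasSum_smul_comp hT (fourierSum μ f) (h0 n) (hu n)).eventually
      (Metric.ball_mem_nhds _ (by positivity : (0 : ℝ) < 1 / ((n : ℝ) + 1)))
    obtain ⟨F, hF⟩ := h.exists
    exact ⟨F, by rwa [dist_comm, dist_eq_norm] at hF⟩
  choose F hF using hF
  have hXsq : ∀ n, ∫ x, X n x ^ 2 ∂μ = ‖toL2 μ (XC n)‖ ^ 2 := by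
    intro n
    simp only [norm_toL2_sq, hXC, Complex.norm_real, Real.norm_eq_abs, sq_abs]
  have hv0 : 0 ≤ v := ge_of_tendsto' hv fun n => integral_nonneg fun x => sq_nonneg _
  have hsqrt : ∀ n, √(∑ ℓ ∈ F n, u n ℓ ^ 2) ≤ 1 := fun n =>
    Real.sqrt_le_one.2 (hsq n (F n))
  set A := ∑' χ, ‖c χ‖ with hA
  have hA0 : 0 ≤ A := tsum_nonneg fun _ => norm_nonneg _
  have hXA : ∀ n, ‖toL2 μ (XC n)‖ ≤ A + 1 := by
    intro n
    have h1 : ‖toL2 μ (weightedSum hT (u n) (F n) (fourierSum μ f))‖ ≤ A :=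
      (norm_toL2_sum_le μ hT hTerg hf.summable hf.fourierCoefficient_one hf.hasSum (u n)
        (F n)).trans (mul_le_of_le_one_right hA0 (hsqrt n))
    have h2 := norm_toL2_le μ (XC n - weightedSum hT (u n) (F n) (fourierSum μ f))
    have h3 : 1 / ((n : ℝ) + 1) ≤ 1 := by
      rw [div_le_one (by positivity)]
      linarith [(Nat.cast_nonneg n : (0 : ℝ) ≤ n)]
    rw [map_sub] at h2
    have h4 := norm_le_norm_add_norm_sub' (toL2 μ (XC n))
      (toL2 μ (weightedSum hT (u n) (F n) (fourierSum μ f)))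
    linarith [hF n]
  -- With `δ = 1 / (n + 1) + ε` bounding the `L²` distance to the truncated sum, the first term is
  -- the change of characteristic function and the second the change of variance. `R` collects what
  -- vanishes for fixed `ε`: the Gaussian error of the polynomial and the convergence of the
  -- variances.
  have hmain : ∀ ε : ℝ, 0 < ε → ∃ R : ℕ → ℝ, Tendsto R atTop (𝓝 0) ∧ ∀ n,
      ‖(∫ x, Complex.exp (t * X n x * Complex.I) ∂μ) - Complex.exp (-(t ^ 2 * v / 2))‖ ≤
        |t| * (1 / ((n : ℝ) + 1) + ε) + t ^ 2 / 2 * ((1 / ((n : ℝ) + 1) + ε) *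
          (2 * (A + 1) + (1 / ((n : ℝ) + 1) + ε))) + R n := by
    intro ε hε
    obtain ⟨Φ, hsymm, hΦ⟩ := exists_symm_tsum_lt c hε
    set ZC : ℕ → C(G, ℂ) := fun n => weightedSum hT (u n) (F n) (trigPoly Φ c)
    let Z : ℕ → G → ℝ := fun n x => (ZC n x).re
    have hZ : ∀ n x, (Z n x : ℂ) = ZC n x := by
      intro n x
      have hreal : ZC n x = ((∑ ℓ ∈ F n, u n ℓ * (trigPoly Φ c (act T ℓ x)).re : ℝ) : ℂ) := by
        simp only [ZC, weightedSum_apply]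
        push_cast
        refine Finset.sum_congr rfl fun ℓ _ => ?_
        rw [hcdef, ofReal_re_trigPoly hsymm]
      simp only [Z]
      rw [hreal, Complex.ofReal_re]
    have hcontZ : ∀ n, Continuous (Z n) := fun n => by fun_prop
    have hsumind : Summable fun χ => ‖((Φ : Set (PontryaginDual G))ᶜ).indicator c χ‖ := by
      simp only [norm_indicator_eq_indicator_norm]
      exact hf.summable.indicator _
    have hdist : ∀ n, ‖toL2 μ (XC n - ZC n)‖ ≤ 1 / ((n : ℝ) + 1) + ε := by
      intro n
      have hYZ : weightedSum hT (u n) (F n) (fourierSum μ f) - ZC n =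
          weightedSum hT (u n) (F n) (fourierSum μ f - trigPoly Φ c) := by
        ext x
        simp only [ZC, ContinuousMap.sub_apply, weightedSum_apply, mul_sub, Finset.sum_sub_distrib]
      have h1 : ‖toL2 μ (weightedSum hT (u n) (F n) (fourierSum μ f) - ZC n)‖ ≤ ε := by
        rw [hYZ]
        refine (norm_toL2_sum_le μ hT hTerg hsumind ?_ (hasSum_sub_trigPoly hf.hasSum Φ) (u n)
          (F n)).trans ((mul_le_of_le_one_right (tsum_nonneg fun _ => norm_nonneg _)
            (hsqrt n)).trans hΦ.le)
        exact Set.indicator_apply_eq_zero.2 fun _ => hf.fourierCoefficient_one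
      have h2 := norm_toL2_le μ (XC n - weightedSum hT (u n) (F n) (fourierSum μ f))
      have h3 := norm_add_le (toL2 μ (XC n - weightedSum hT (u n) (F n) (fourierSum μ f)))
        (toL2 μ (weightedSum hT (u n) (F n) (fourierSum μ f) - ZC n))
      rw [← map_add, sub_add_sub_cancel] at h3
      linarith [hF n]
    have hZsq : ∀ n, ∫ x, Z n x ^ 2 ∂μ = ‖toL2 μ (ZC n)‖ ^ 2 := by
      intro n
      simp only [norm_toL2_sq, ← hZ, Complex.norm_real, Real.norm_eq_abs, sq_abs]
    have hnorm : ∀ n, |‖toL2 μ (XC n)‖ - ‖toL2 μ (ZC n)‖| ≤ 1 / ((n : ℝ) + 1) + ε := fun n => by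
      refine (abs_norm_sub_norm_le _ _).trans ?_
      rw [← map_sub]
      exact hdist n
    have hn1 : ∀ n : ℕ, 1 / ((n : ℝ) + 1) ≤ 1 := fun n => by
      rw [div_le_one (by positivity)]
      linarith [(Nat.cast_nonneg n : (0 : ℝ) ≤ n)]
    have hV : ∀ n, ∫ x, Z n x ^ 2 ∂μ ≤ (A + 2 + ε) ^ 2 := by
      intro n
      rw [hZsq]
      have := (abs_le.1 (hnorm n)).1
      have := hXA n
      have := hn1 n
      exact pow_le_pow_left₀ (norm_nonneg _) (by linarith) 2
    have hclt := tendsto_charFun_trigPoly hT h0 hu hmix F Φ hf.fourierCoefficient_one hZ hV t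
    refine ⟨fun n => ‖(∫ x, Complex.exp (t * Z n x * Complex.I) ∂μ) -
      Complex.exp (-(t ^ 2 * (∫ x, Z n x ^ 2 ∂μ : ℝ) / 2))‖ +
      t ^ 2 / 2 * |∫ x, X n x ^ 2 ∂μ - v|, ?_, fun n => ?_⟩
    · have h1 : Tendsto (fun n => t ^ 2 / 2 * |∫ x, X n x ^ 2 ∂μ - v|) atTop (𝓝 0) := by
        have h := ((hv.sub_const v).abs).const_mul (t ^ 2 / 2)
        rwa [sub_self, abs_zero, mul_zero] at h
      simpa using hclt.norm.add h1
    · have e1 : ‖(∫ x, Complex.exp (t * X n x * Complex.I) ∂μ) -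
          ∫ x, Complex.exp (t * Z n x * Complex.I) ∂μ‖ ≤ |t| * (1 / ((n : ℝ) + 1) + ε) := by
        refine (norm_integral_exp_sub_le μ (hcontX n) (hcontZ n) t).trans ?_
        refine mul_le_mul_of_nonneg_left ?_ (abs_nonneg t)
        refine le_trans (le_of_eq ?_) ((integral_norm_le_norm_toL2 μ (XC n - ZC n)).trans (hdist n))
        refine integral_congr_ae (Eventually.of_forall fun x => ?_)
        simp only [ContinuousMap.sub_apply]
        rw [hXC, ← hZ, ← Complex.ofReal_sub, Complex.norm_real, Real.norm_eq_abs]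
      have e2 : ∀ {a b : ℝ}, 0 ≤ a → 0 ≤ b →
          ‖Complex.exp (-(t ^ 2 * (a : ℂ) / 2)) - Complex.exp (-(t ^ 2 * (b : ℂ) / 2))‖ ≤
            t ^ 2 / 2 * |a - b| := by
        intro a b ha hb
        have h := norm_exp_neg_sub_le (a := t ^ 2 * a / 2) (b := t ^ 2 * b / 2) (by positivity)
          (by positivity)
        push_cast at h
        refine h.trans (le_of_eq ?_)
        rw [show t ^ 2 * a / 2 - t ^ 2 * b / 2 = t ^ 2 / 2 * (a - b) by ring, abs_mul,
          abs_of_nonneg (by positivity : 0 ≤ t ^ 2 / 2)]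
      have hX0 : 0 ≤ ∫ x, X n x ^ 2 ∂μ := integral_nonneg fun x => sq_nonneg _
      have hZ0 : 0 ≤ ∫ x, Z n x ^ 2 ∂μ := integral_nonneg fun x => sq_nonneg _
      have e3 := e2 hZ0 hX0
      have e4 := e2 hX0 hv0
      -- Difference of squares of norms: the sum of the two norms is at most twice that of `XC n`
      -- plus their distance.
      have e5 : |∫ x, Z n x ^ 2 ∂μ - ∫ x, X n x ^ 2 ∂μ| ≤ (1 / ((n : ℝ) + 1) + ε) *
          (2 * (A + 1) + (1 / ((n : ℝ) + 1) + ε)) := by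
        rw [hZsq, hXsq, sq_sub_sq, abs_mul, mul_comm, abs_sub_comm]
        have h1 := hnorm n
        have h2 := hXA n
        have h3 := (abs_le.1 h1).1
        rw [abs_of_nonneg (by positivity : 0 ≤ ‖toL2 μ (ZC n)‖ + ‖toL2 μ (XC n)‖)]
        exact mul_le_mul h1 (by linarith) (by positivity) (by positivity)
      have e6 := mul_le_mul_of_nonneg_left e5 (by positivity : 0 ≤ t ^ 2 / 2)
      have e7 := norm_sub_le_norm_sub_add_norm_sub (∫ x, Complex.exp (t * X n x * Complex.I) ∂μ)
        (∫ x, Complex.exp (t * Z n x * Complex.I) ∂μ) (Complex.exp (-(t ^ 2 * v / 2)))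
      have e8 := norm_sub_le_norm_sub_add_norm_sub (∫ x, Complex.exp (t * Z n x * Complex.I) ∂μ)
        (Complex.exp (-(t ^ 2 * (∫ x, Z n x ^ 2 ∂μ : ℝ) / 2))) (Complex.exp (-(t ^ 2 * v / 2)))
      have e9 := norm_sub_le_norm_sub_add_norm_sub
        (Complex.exp (-(t ^ 2 * (∫ x, Z n x ^ 2 ∂μ : ℝ) / 2)))
        (Complex.exp (-(t ^ 2 * (∫ x, X n x ^ 2 ∂μ : ℝ) / 2))) (Complex.exp (-(t ^ 2 * v / 2)))
      linarith
  rw [tendsto_iff_norm_sub_tendsto_zero]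
  have hbound : Tendsto (fun δ : ℝ => |t| * δ + t ^ 2 / 2 * (δ * (2 * (A + 1) + δ))) (𝓝 0)
      (𝓝 0) := by
    have : Continuous fun δ : ℝ => |t| * δ + t ^ 2 / 2 * (δ * (2 * (A + 1) + δ)) := by fun_prop
    simpa using this.tendsto 0
  rw [Metric.tendsto_atTop]
  intro η hη
  obtain ⟨ρ, hρ, hδ⟩ := Metric.eventually_nhds_iff.1 ((tendsto_order.1 hbound).2 (η / 2)
    (half_pos hη))
  -- The truncation is fixed here, before `n` grows, since `R` depends on it.
  obtain ⟨R, hR, hle⟩ := hmain (ρ / 2) (half_pos hρ)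
  have hev : ∀ᶠ n : ℕ in atTop, 1 / ((n : ℝ) + 1) < ρ / 2 :=
    (tendsto_order.1 tendsto_one_div_add_atTop_nhds_zero_nat).2 _ (half_pos hρ)
  obtain ⟨N, hN⟩ := eventually_atTop.1 (hev.and ((tendsto_order.1 hR).2 (η / 2) (half_pos hη)))
  refine ⟨N, fun n hn => ?_⟩
  have hpos : 0 < 1 / ((n : ℝ) + 1) := by positivity
  have h1 := hδ (y := 1 / ((n : ℝ) + 1) + ρ / 2) (by
    rw [dist_zero_right, Real.norm_of_nonneg (by positivity)]
    linarith [(hN n hn).1])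
  rw [dist_zero_right, norm_norm]
  linarith [hle n, (hN n hn).2]

lemma sumSq_pos {w : (Fin d → ℤ) → ℝ} (h0 : ∀ ℓ, 0 ≤ w ℓ) (hw : Summable w)
    (hpos : 0 < ∑' ℓ, w ℓ) : (Summable fun ℓ => w ℓ ^ 2) ∧ 0 < sumSq w := by
  have hs : Summable fun ℓ => w ℓ ^ 2 := by
    refine Summable.of_nonneg_of_le (fun ℓ => sq_nonneg _) (fun ℓ => ?_)
      (hw.mul_left (∑' ℓ, w ℓ))
    rw [sq]
    exact mul_le_mul_of_nonneg_right (hw.le_tsum ℓ fun k _ => h0 k) (h0 ℓ)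
  refine ⟨hs, ?_⟩
  obtain ⟨ℓ, hℓ⟩ : ∃ ℓ, w ℓ ≠ 0 := by
    by_contra! h
    simp [h] at hpos
  exact hs.tsum_pos (fun k => sq_nonneg _) ℓ (by positivity)

end CentralLimit

end CLTAction

end

/-! ### The main theorem -/

theorem theorem3p6 {d : ℕ} (hd : 1 ≤ d)
    {G : Type*} [CommGroup G] [TopologicalSpace G] [IsTopologicalGroup G] [CompactSpace G]
    [T2Space G] [MeasurableSpace G] [BorelSpace G]
    (μ : Measure G) [μ.IsHaarMeasure] [IsProbabilityMeasure μ]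
    (T : Multiplicative (Fin d → ℤ) →* MulAut G)
    (hT : ∀ ℓ, Continuous (CLTAction.act T ℓ))
    (hTerg : CLTAction.IsTotallyErgodic T μ)
    (w : ℕ → (Fin d → ℤ) → ℝ) (hw : CLTAction.IsSummationSequence w)
    (ζ : Measure (UnitAddTorus (Fin d))) [IsProbabilityMeasure ζ]
    (hwζ : CLTAction.IsRegularSequence w ζ)
    (f : G → ℝ) (hf : CLTAction.IsRegularFunction μ f)
    (hmix : ∀ r : ℕ, 3 ≤ r → ∀ Φ : Finset (PontryaginDual G),
      (fun n => ∑' a : CLTAction.nonMixing T μ Φ r, ∏ j, w n (a.1 j)) =o[atTop]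
        fun n => CLTAction.sumSq (w n) ^ ((r : ℝ) / 2)) :
    (∃ φ : C(UnitAddTorus (Fin d), ℝ), CLTAction.IsSpectralDensity T μ f φ) ∧
    ∀ φ : C(UnitAddTorus (Fin d), ℝ), CLTAction.IsSpectralDensity T μ f φ →
      0 < ∫ t, φ t ∂ζ →
      TendstoInDistribution (fun n => CLTAction.normalizedSum T (w n) f) atTop
        (id : ℝ → ℝ) (fun _ => μ) (gaussianReal 0 (∫ t, φ t ∂ζ).toNNReal) := by
  refine ⟨CLTAction.exists_isSpectralDensity hT hTerg hf, fun φ hφ hv => ?_⟩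
  set s : ℕ → ℝ := fun n => CLTAction.sumSq (w n) ^ (-(1 / 2) : ℝ) with hs
  have hpos : ∀ n, 0 < CLTAction.sumSq (w n) := fun n =>
    (CLTAction.sumSq_pos (hw.nonneg n) (hw.summable n) (hw.pos n)).2
  have hs0 : ∀ n, 0 < s n := fun n => Real.rpow_pos_of_pos (hpos n) _
  have hspow : ∀ n r : ℕ, s n ^ r = (CLTAction.sumSq (w n) ^ ((r : ℝ) / 2))⁻¹ := fun n r => by
    rw [hs, ← Real.rpow_natCast, ← Real.rpow_mul (hpos n).le, ← Real.rpow_neg (hpos n).le]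
    congr 1
    ring
  have hssq : ∀ n, s n ^ 2 = (CLTAction.sumSq (w n))⁻¹ := fun n => by
    rw [hspow]
    norm_num
  set u : ℕ → (Fin d → ℤ) → ℝ := fun n ℓ => s n * w n ℓ with hu
  have hu0 : ∀ n ℓ, 0 ≤ u n ℓ := fun n ℓ => mul_nonneg (hs0 n).le (hw.nonneg n ℓ)
  have hus : ∀ n, Summable (u n) := fun n => (hw.summable n).mul_left (s n)
  have husq : ∀ n (F : Finset (Fin d → ℤ)), ∑ ℓ ∈ F, u n ℓ ^ 2 ≤ 1 := by
    intro n F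
    simp only [hu, mul_pow, ← Finset.mul_sum, hssq]
    rw [inv_mul_le_one₀ (hpos n)]
    exact (CLTAction.sumSq_pos (hw.nonneg n) (hw.summable n) (hw.pos n)).1.sum_le_tsum F
      fun ℓ _ => sq_nonneg _
  have humix : ∀ r : ℕ, 3 ≤ r → ∀ Φ : Finset (PontryaginDual G),
      Tendsto (fun n => ∑' a : CLTAction.nonMixing T μ Φ r, ∏ j, u n (a.1 j)) atTop (𝓝 0) := by
    intro r hr Φ
    -- Each of the `r` weights carries a factor `s n`, and `s n ^ r` is the inverse of the
    -- comparison function of `hmix`.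
    refine (hmix r hr Φ).tendsto_div_nhds_zero.congr fun n => ?_
    simp only [hu, Finset.prod_mul_distrib, Finset.prod_const, Finset.card_univ, Fintype.card_fin]
    rw [tsum_mul_left, hspow, div_eq_inv_mul]
  have hX : ∀ n x, CLTAction.normalizedSum T (w n) f x =
      ∑' ℓ, u n ℓ * f (CLTAction.act T ℓ x) := fun n x => by
    simp only [CLTAction.normalizedSum, hu, mul_assoc, tsum_mul_left, hs]
  have hvar : Tendsto (fun n => ∫ x, CLTAction.normalizedSum T (w n) f x ^ 2 ∂μ) atTop
      (𝓝 (∫ t, φ t ∂ζ)) := by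
    -- Weak convergence is tested on the spectral density itself, which is possible because it is
    -- continuous.
    refine (hwζ φ).congr fun n => ?_
    simp only [CLTAction.normalizedSum, mul_pow]
    rw [integral_const_mul, CLTAction.integral_sq_tsum hT hTerg hf hφ (hw.nonneg n)
      (hw.summable n), ← integral_const_mul]
    refine integral_congr_ae (Eventually.of_forall fun t => ?_)
    have h2 := hssq n
    simp only [hs] at h2
    simp only [CLTAction.kernel]
    rw [h2]
    ring
  have hcont : ∀ n, Continuous (CLTAction.normalizedSum T (w n) f) := fun n => by
    have : CLTAction.normalizedSum T (w n) f = fun x =>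
        ((∑' ℓ, (u n ℓ : ℂ) • (CLTAction.fourierSum μ f).comp (CLTAction.actMap hT ℓ) :
          C(G, ℂ)) x).re := by
      ext x
      rw [CLTAction.tsum_smul_comp_apply hT hf (hu0 n) (hus n), Complex.ofReal_re, hX]
    rw [this]
    fun_prop
  have hmeas : ∀ n, AEMeasurable (CLTAction.normalizedSum T (w n) f) μ := fun n =>
    (hcont n).measurable.aemeasurable
  refine ⟨hmeas, aemeasurable_id, ?_⟩
  refine ProbabilityMeasure.tendsto_iff_tendsto_charFun.2 fun t => ?_
  have hlim := CLTAction.tendsto_charFun_tsum hT hTerg hf hu0 hus husq humix hX hvar t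
  -- Positivity of the variance makes the truncation in `toNNReal` harmless.
  simp only [ProbabilityMeasure.coe_mk, Measure.map_id, charFun_gaussianReal,
    Real.coe_toNNReal _ hv.le]
  have hexp : Complex.exp (t * (0 : ℝ) * Complex.I - (∫ t, φ t ∂ζ : ℝ) * t ^ 2 / 2) =
      Complex.exp (-(t ^ 2 * (∫ t, φ t ∂ζ : ℝ) / 2)) := by
    congr 1
    push_cast
    ring
  rw [hexp]
  refine hlim.congr fun n => ?_
  rw [charFun_apply_real, integral_map (hmeas n) (by fun_prop)]
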